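/- Let $\Omega=(x_i,x_f)\subseteq\mathbb R$ be a bounded or unbounded open interval, and let $f,h$ be probability densities on $\Omega$ that are positive on $\Omega$. Every density below lives on an open interval. **Transformations.** Let $\alpha\ne0$, $\gamma\neq2$. * $\mathfrak R_\alpha^{[h]}[f](y)=\big(f(x(y))/h(x(y))\big)^{\alpha}$, with $y'(x)=f(x)^{1-\alpha}h(x)^{\alpha}$. * For a density $g$ let $r=\big(\int g^{(\alpha-1)/\alpha}\big)^{\alpha}$ (the length of the interval of $g$ if $\alpha=1$). If the integral is finite, say that $g$ is *admissible*, and put $\mathfrak R_\alpha^{-1,[h]}[g](x)=[r\,g(r\,y(x))]^{1/\alpha}h(x)$ for $x\in\Omega$, where $y$ maps $\Omega$ increasingly onto the interval of $t\mapsto r g(rt)$ and $y'(x)=[r\,g(r\,y(x))]^{\frac1\alpha-1}h(x)$. * Up transformation: $\mathfrak U_\gamma[g](u)=|(\gamma-2)x(u)|^{\frac1{2-\gamma}}$, with $u'(x)=-|(\gamma-2)x|^{\frac1{\gamma-2}}g(x)$. * Down transformation of a strictly monotone, almost everywhere differentiable density $g$: $\mathfrak D_\gamma[g](s)=g(x(s))^{\gamma}\,|g'(x(s))|^{-1}$,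 with $s(x)=g(x)^{2-\gamma}/|\gamma-2|$, so that $|s'|=g^{1-\gamma}|g'|$. With this choice $\mathfrak D_\gamma\circ\mathfrak U_\gamma$ is the identity on densities that live in $(0,\infty)$. * For $\delta\in(0,1)$ let $K=\int_\Omega h^\delta f^{1-\delta}$ and $\mathfrak A^{(h)}_\delta[f](y)=K\,\big(f(x(y))/h(x(y))\big)^{\delta}h(y)$, where $y:\Omega\to\Omega$ is given by $\int_{x_i}^{y(x)}h=\frac1{K}\int_{x_i}^x f^{1-\delta}h^\delta$. The variables $y$ in $\mathfrak R_\alpha^{[h]}$ and $u$ in $\mathfrak U_\gamma$ are normalized by $y(x_i)=0$, respectively by $u=0$ at the right end of the interval, if the defining integral converges there, and by the value $0$ at some interior point otherwise. Put $$\mathfrak U_{\gamma,\alpha}^{\mathfrak R,[h]}=\mathfrak R_\alpha^{-1,[h]}\circ\mathfrak U_\gamma\circ\mathfrak R_\alpha^{[h]},\qquad \mathfrak D_{\gamma,\alpha}^{\mathfrak R,[h]}=\mathfrak R_\alpha^{-1,[h]}\circ\mathfrak D_\gamma\circ\mathfrak R_\alpha^{[h]},\qquad \mathfrak T_\delta=\mathfrak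 D_{\gamma,\alpha}^{\mathfrak R,[h]}\circ\mathfrak A_\delta^{(h)}\circ\mathfrak U_{\gamma,\alpha}^{\mathfrak R,[h]}.$$ **Moments and complexity.** For $\lambda,\beta\in\mathbb R\setminus\{0\}$ let $$\mu_{\lambda,\alpha}[f\|h]=\int_\Omega\Big(\int_{x_i}^x f(s)^{1-\alpha}h(s)^\alpha ds\Big)^{\lambda}f(x)\,dx\in[0,\infty],\qquad C_{\lambda,\beta,\gamma,\alpha}[f\|h]=\frac{\mu_{\lambda,\alpha}[f\|h]^{\frac1{(\gamma-2)\lambda}}}{\mu_{\beta,\alpha}[f\|h]^{\frac1{(\gamma-2)\beta}}}\in[0,\infty].$$ **Theorem.** Let $\lambda,\beta\in\mathbb R\setminus\{0\}$, $\gamma\in\mathbb R\setminus\{2\}$, $\alpha\in\mathbb R\setminus\{0\}$ with $\operatorname{sign}(\lambda-\beta)=\operatorname{sign}(\alpha)\operatorname{sign}(\gamma-2)$, let $\delta\in(0,1)$, and let $f,h$ be as above. Assume that $C_{\lambda,\beta,\gamma,\alpha}[f\|h]$ is well defined, that is, $\int_{x_i}^xf^{1-\alpha}h^\alpha<\infty$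 for all $x\in\Omega$, and $\mu_{\lambda,\alpha}[f\|h]$, $\mu_{\beta,\alpha}[f\|h]$ are not both infinite if $\lambda\beta>0$. Assume also that $\mathfrak T_\delta[f]$ is defined, that is, the two densities to which $\mathfrak R_\alpha^{-1,[h]}$ is applied in $\mathfrak T_\delta[f]$ are admissible. Then $$C_{\lambda,\beta,\gamma,\alpha}\big[\mathfrak T_\delta[f]\,\big\|\,h\big]^{\frac1\alpha}\le C_{\lambda,\beta,\gamma,\alpha}[f\|h]^{\frac1\alpha}.$$ Here the inner integral $\int_{x_i}^x\mathfrak T_\delta[f]^{1-\alpha}h^\alpha$ is finite for all $x\in\Omega$, and each of the moments of order $\lambda$ and $\beta$ of $\mathfrak T_\delta[f]$ is finite if that of $f$ is. -/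

import Mathlib

open MeasureTheory Set
open scoped ENNReal

noncomputable section

/-- A real function together with the open interval on which it is regarded as a density.
The values of `val` outside `dom` are irrelevant. -/
structure LineDensity where
  dom : Set ℝ
  val : ℝ → ℝ

namespace LineDensity

/-- `f` is a probability density, positive on the open (bounded or unbounded) interval `f.dom`. -/
structure IsPDF (f : LineDensity) : Prop where
  isOpen : IsOpen f.dom
  ordConnected : f.dom.OrdConnected
  aemeasurable : AEMeasurable f.val (volume.restrict f.dom)
  pos : ∀ x ∈ f.dom, 0 < f.val x
  mass : ∫⁻ x in f.dom, ENNReal.ofReal (f.val x) = 1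

/-- Some point of the set `D` (when `D` is nonempty). -/
def basePoint (D : Set ℝ) : ℝ := Classical.epsilon fun x => x ∈ D

open Classical in
/-- A primitive of `w` on the open interval `D`: the one vanishing at the left end of `D` if `w`
is integrable there, and otherwise the one vanishing at some interior point. -/
def primitiveFromLeft (D : Set ℝ) (w : ℝ → ℝ) (x : ℝ) : ℝ :=
  if ∀ z ∈ D, IntegrableOn w (D ∩ Iio z) then ∫ t in D ∩ Iio x, w t
  else ∫ t in basePoint D..x, w t

open Classical in
/-- A primitive of `-w` on the open interval `D`: the one vanishing at the right end of `D` if `w`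
is integrable there, and otherwise the one vanishing at some interior point. -/
def primitiveFromRight (D : Set ℝ) (w : ℝ → ℝ) (x : ℝ) : ℝ :=
  if ∀ z ∈ D, IntegrableOn w (D ∩ Ioi z) then ∫ t in D ∩ Ioi x, w t
  else ∫ t in x..basePoint D, w t

/-- The change of variable `y`, with derivative `f ^ (1 - α) * h ^ α`, of the relative
differential-escort transformation. -/
def escortVar (α : ℝ) (h f : LineDensity) : ℝ → ℝ :=
  primitiveFromLeft f.dom fun t => f.val t ^ (1 - α) * h.val t ^ α

/-- The relative differential-escort transformation: `(f (x y) / h (x y)) ^ α`, where `y ↦ x y` is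
the inverse of the change of variable. -/
def relEscort (α : ℝ) (h f : LineDensity) : LineDensity where
  dom := escortVar α h f '' f.dom
  val y :=
    let x := Function.invFunOn (escortVar α h f) f.dom y
    (f.val x / h.val x) ^ α

/-- The Rényi entropy power `N_p`, for `p ≠ 1`. -/
def renyiPower (p : ℝ) (g : LineDensity) : ℝ :=
  (∫ x in g.dom, g.val x ^ p) ^ (1 / (1 - p))

/-- Scaling change `x ↦ a * g (a * x)`. -/
def scale (a : ℝ) (g : LineDensity) : LineDensity where
  dom := {x | a * x ∈ g.dom}
  val x := a * g.val (a * x)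

/-- The condition on `g` under which the inverse relative differential-escort transformation of
order `α` may be applied to it: its Rényi entropy power of order `(α - 1) / α` is a positive real
number, that is, the integral in it is finite. For `α = 1` it says that `g.dom` is bounded. -/
def InverseAdmissible (α : ℝ) (g : LineDensity) : Prop :=
  IntegrableOn (fun x => g.val x ^ ((α - 1) / α)) g.dom

/-- The scaling factor `r` of the inverse relative differential-escort transformation. For `α = 1`
it is the length of `g.dom`. -/
def inverseRatio (α : ℝ) (g : LineDensity) : ℝ := renyiPower ((α - 1) / α) g

/-- Distribution function of `h`. -/
def cdf (h : LineDensity) (x : ℝ) : ℝ := ∫ t in h.dom ∩ Iio x, h.val t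

/-- The change of variable `x ↦ y x` from `h.dom` onto the domain of `k = scale r g`, increasing
with `y' = (k ∘ y) ^ (-(1 - 1 / α)) * h`. After separation of variables it is given by
`∫ t in (left end)..y x, k t ^ (1 - 1 / α) = cdf h x`. -/
def invEscortVar (α : ℝ) (h g : LineDensity) (x : ℝ) : ℝ :=
  let k := scale (inverseRatio α g) g
  Function.invFunOn (fun y => ∫ t in k.dom ∩ Iio y, k.val t ^ (1 - 1 / α)) k.dom (cdf h x)

/-- The inverse relative differential-escort transformation with reference density `h`. -/
def invRelEscort (α : ℝ) (h g : LineDensity) : LineDensity where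
  dom := h.dom
  val x := (scale (inverseRatio α g) g).val (invEscortVar α h g x) ^ (1 / α) * h.val x

/-- `K_p[f ‖ h]`, the integral of `f ^ p * h ^ (1 - p)`. -/
def renyiK (p : ℝ) (f h : LineDensity) : ℝ :=
  ∫ t in f.dom, f.val t ^ p * h.val t ^ (1 - p)

/-- The change of variable `y : Ω → Ω` of the divergence transformation of order `δ`. -/
def divergenceVar (δ : ℝ) (h f : LineDensity) (x : ℝ) : ℝ :=
  Function.invFunOn (cdf h) h.dom
    ((∫ t in f.dom ∩ Iio x, f.val t ^ (1 - δ) * h.val t ^ δ) / renyiK δ h f)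

/-- The divergence transformation of order `δ` with reference density `h`. -/
def divergenceTransform (δ : ℝ) (h f : LineDensity) : LineDensity where
  dom := h.dom
  val y :=
    let x := Function.invFunOn (divergenceVar δ h f) f.dom y
    renyiK δ h f * (f.val x / h.val x) ^ δ * h.val y

/-- The change of variable `u` of the up transformation of order `γ ≠ 2`, with derivative
`- |(γ - 2) * x| ^ (1 / (γ - 2)) * g x`. -/
def upVar (γ : ℝ) (g : LineDensity) : ℝ → ℝ :=
  primitiveFromRight g.dom fun t => |(γ - 2) * t| ^ (1 / (γ - 2)) * g.val t

/-- The up transformation of order `γ ≠ 2`. -/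
def up (γ : ℝ) (g : LineDensity) : LineDensity where
  dom := upVar γ g '' g.dom
  val u := |(γ - 2) * Function.invFunOn (upVar γ g) g.dom u| ^ (1 / (2 - γ))

/-- The change of variable `s` of the down transformation of order `γ ≠ 2`, with
`|s'| = g ^ (1 - γ) * |g'|`. The sign and the additive constant are those for which the down
transformation inverts the up transformation on densities living on a half line `x > 0`. -/
def downVar (γ : ℝ) (g : LineDensity) (x : ℝ) : ℝ := g.val x ^ (2 - γ) / |γ - 2|

/-- The down transformation of order `γ ≠ 2` of a strictly monotone (almost everywhere
differentiable) density: `g ^ γ / |g'|` in the variable `s`. -/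
def down (γ : ℝ) (g : LineDensity) : LineDensity where
  dom := downVar γ g '' g.dom
  val s :=
    let x := Function.invFunOn (downVar γ g) g.dom s
    g.val x ^ γ * |deriv g.val x|⁻¹

/-- The up transformation conjugated by the relative differential-escort transformation. -/
def relUp (γ α : ℝ) (h f : LineDensity) : LineDensity :=
  invRelEscort α h (up γ (relEscort α h f))

/-- The down transformation conjugated by the relative differential-escort transformation. -/
def relDown (γ α : ℝ) (h f : LineDensity) : LineDensity :=
  invRelEscort α h (down γ (relEscort α h f))

/-- The divergence transformation of order `δ` conjugated by `relUp` and `relDown`. -/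
def conjugatedDivergence (γ α δ : ℝ) (h f : LineDensity) : LineDensity :=
  relDown γ α h (divergenceTransform δ h (relUp γ α h f))

/-- The inner integral of `f ^ (1 - α) * h ^ α` from the left end of the interval to `x`. -/
def relCumulative (α : ℝ) (f h : LineDensity) (x : ℝ) : ℝ≥0∞ :=
  ∫⁻ s in f.dom ∩ Iio x, ENNReal.ofReal (f.val s ^ (1 - α) * h.val s ^ α)

/-- The relative cumulative moment `μ_{p,α}[f ‖ h]`, with values in `[0, ∞]`. -/
def relCumulativeMoment (p α : ℝ) (f h : LineDensity) : ℝ≥0∞ :=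
  ∫⁻ x in f.dom, relCumulative α f h x ^ p * ENNReal.ofReal (f.val x)

/-- The relative cumulative-moment complexity. -/
def momentComplexity (p q γ α : ℝ) (f h : LineDensity) : ℝ≥0∞ :=
  relCumulativeMoment p α f h ^ (1 / ((γ - 2) * p)) /
    relCumulativeMoment q α f h ^ (1 / ((γ - 2) * q))

end LineDensity

end

/-! Everything is read in the variable `t = y(x)`, the integral of `f ^ (1 - α) * h ^ α` up to `x`.
If `F` is the escort density of `f`, then the moment of order `p` of `f` is the `p`-th moment of a
random variable `t` with density `F` on an interval starting at `0`. Each transformation is a change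
of variable that preserves mass, so only the ratio to `h`, raised to the power `α`, has to be
followed. After the up transformation and the inverse escort this ratio is a constant times `t ^ (1
/ (2 - γ))`. The divergence transformation raises it to the power `δ` and multiplies it by a
constant. The down variable is a multiple of the power `2 - γ` of the ratio, hence it equals `c' * t
^ δ`. The last inverse escort only rescales the cumulative variable, so `conjugatedDivergence_spec`
gives moments of order `p` of the form `C ^ p` times the moment of order `δ * p` of `f`.

The factor `C` cancels in the complexity. By Hölder the logarithm `φ` of the moment is convex in the
order, and the inequality becomes a comparison of the secant slopes of `φ` on `[δ q, q]` and `[δ p,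
p]`. The sign condition makes division by `α * (γ - 2)` give the right direction. If a moment of `f`
is infinite, then the sign condition and log-convexity with finite moment of order `0` force the
right-hand side to be infinite (`div_rpow_le_of_logConvex`).

The densities are merely measurable, so the changes of variable are handled as transports of
measure. In `ChangeOfVar` the test functions are arbitrary, which avoids measurability proofs for
the inverse functions that appear. Only the down transformation needs a derivative, and only almost
everywhere. -/

/-- `D` is an open interval of the line, bounded or not (possibly empty). -/
structure IsOpenInterval (D : Set ℝ) : Prop where
  isOpen : IsOpen D
  ordConnected : D.OrdConnected

/-- `Θ` is a bijection from `D` to `E` which transports the measure with density `w` on `D` to the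
measure with density `v` on `E`, and which transports null sets and measurability. -/
structure ChangeOfVar (Θ : ℝ → ℝ) (D : Set ℝ) (w : ℝ → ℝ) (E : Set ℝ) (v : ℝ → ℝ) : Prop where
  bijOn : BijOn Θ D E
  lintegral_eq : ∀ φ : ℝ → ℝ≥0∞,
    ∫⁻ t in E, φ t * ENNReal.ofReal (v t) = ∫⁻ x in D, φ (Θ x) * ENNReal.ofReal (w x)
  aemeasurable_iff : ∀ φ : ℝ → ℝ,
    AEMeasurable φ (volume.restrict E) ↔ AEMeasurable (fun x => φ (Θ x)) (volume.restrict D)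
  ae_iff : ∀ P : ℝ → Prop,
    (∀ᵐ t ∂volume.restrict E, P t) ↔ ∀ᵐ x ∂volume.restrict D, P (Θ x)

/-! ### Primitives of positive functions as changes of variable. -/

section Primitive

variable {D : Set ℝ} {w W : ℝ → ℝ}

theorem IsOpenInterval.uIcc_subset (hD : IsOpenInterval D) {a b : ℝ} (ha : a ∈ D) (hb : b ∈ D) :
    uIcc a b ⊆ D := hD.ordConnected.uIcc_subset ha hb

theorem IsOpenInterval.Ioc_subset (hD : IsOpenInterval D) {a b : ℝ} (ha : a ∈ D) (hb : b ∈ D) :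
    Ioc a b ⊆ D := fun _ hx => hD.ordConnected.out ha hb ⟨hx.1.le, hx.2⟩

theorem IsOpenInterval.exists_lt (hD : IsOpenInterval D) {x : ℝ} (hx : x ∈ D) :
    ∃ a ∈ D, a < x := by
  obtain ⟨ε, hε, h⟩ := Metric.isOpen_iff.1 hD.isOpen x hx
  refine ⟨x - ε / 2, h ?_, by linarith⟩
  rw [Metric.mem_ball, Real.dist_eq, abs_lt]; constructor <;> linarith

theorem IsOpenInterval.exists_gt (hD : IsOpenInterval D) {x : ℝ} (hx : x ∈ D) :
    ∃ a ∈ D, x < a := by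
  obtain ⟨ε, hε, h⟩ := Metric.isOpen_iff.1 hD.isOpen x hx
  refine ⟨x + ε / 2, h ?_, by linarith⟩
  rw [Metric.mem_ball, Real.dist_eq, abs_lt]; constructor <;> linarith

theorem ae_pos_Ioc (hD : IsOpenInterval D) (hpos : ∀ᵐ x ∂volume.restrict D, 0 < w x)
    {a b : ℝ} (ha : a ∈ D) (hb : b ∈ D) : ∀ᵐ x ∂volume.restrict (Ioc a b), 0 < w x :=
  ae_restrict_of_ae_restrict_of_subset (hD.Ioc_subset ha hb) hpos

/-- The primitive enters only through its increments, so primitives anchored at an end of the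
interval and at an interior point are treated alike. -/
theorem strictMonoOn_of_primitive (hD : IsOpenInterval D)
    (hpos : ∀ᵐ x ∂volume.restrict D, 0 < w x)
    (hint : ∀ a ∈ D, ∀ b ∈ D, IntervalIntegrable w volume a b)
    (hW : ∀ a ∈ D, ∀ b ∈ D, W b - W a = ∫ x in a..b, w x) : StrictMonoOn W D := by
  intro a ha b hb hab
  have h1 := ae_pos_Ioc hD hpos ha hb
  have h2 : 0 < ∫ x in a..b, w x := by
    rw [intervalIntegral.integral_of_le hab.le, setIntegral_pos_iff_support_of_nonneg_ae
      (h1.mono fun x hx => hx.le) (hint a ha b hb).1]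
    have : (Ioc a b : Set ℝ) ≤ᵐ[volume] (Function.support w ∩ Ioc a b : Set ℝ) := by
      rw [ae_restrict_iff' measurableSet_Ioc] at h1
      filter_upwards [h1] with x hx hm
      exact ⟨(hx hm).ne', hm⟩
    refine lt_of_lt_of_le ?_ (measure_mono_ae this)
    simpa using hab
  linarith [hW a ha b hb]

theorem continuousOn_of_primitive (hD : IsOpenInterval D)
    (hint : ∀ a ∈ D, ∀ b ∈ D, IntervalIntegrable w volume a b)
    (hW : ∀ a ∈ D, ∀ b ∈ D, W b - W a = ∫ x in a..b, w x) : ContinuousOn W D := by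
  intro x hx
  obtain ⟨a, ha, hax⟩ := hD.exists_lt hx
  obtain ⟨b, hb, hxb⟩ := hD.exists_gt hx
  have hab : a ≤ b := (hax.trans hxb).le
  have h1 : ContinuousOn (fun y => W a + ∫ t in a..y, w t) (Icc a b) := by
    have := intervalIntegral.continuousOn_primitive_interval' (hint a ha b hb) left_mem_uIcc
    rw [uIcc_of_le hab] at this
    exact continuousOn_const.add this
  have h2 : ContinuousOn W (Icc a b) := h1.congr fun y hy => by
    have := hW a ha y (hD.ordConnected.out ha hb hy)
    linarith
  exact (h2.continuousAt (Icc_mem_nhds hax hxb)).continuousWithinAt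

theorem image_isOpenInterval (hD : IsOpenInterval D) (hm : StrictMonoOn W D)
    (hc : ContinuousOn W D) : IsOpenInterval (W '' D) := by
  refine ⟨?_, ?_⟩
  · rw [isOpen_iff_mem_nhds]
    rintro _ ⟨x, hx, rfl⟩
    obtain ⟨a, ha, hax⟩ := hD.exists_lt hx
    obtain ⟨b, hb, hxb⟩ := hD.exists_gt hx
    have h := hD.ordConnected.out ha hb
    refine Filter.mem_of_superset (Ioo_mem_nhds (hm ha hx hax) (hm hx hb hxb)) ?_
    exact (intermediate_value_Ioo (hax.trans hxb).le (hc.mono h)).trans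
      (image_mono (Ioo_subset_Icc_self.trans h))
  · exact (hD.ordConnected.isPreconnected.image _ hc).ordConnected

theorem lintegral_Ioc_of_primitive (hD : IsOpenInterval D)
    (hpos : ∀ᵐ x ∂volume.restrict D, 0 < w x)
    (hint : ∀ a ∈ D, ∀ b ∈ D, IntervalIntegrable w volume a b)
    (hW : ∀ a ∈ D, ∀ b ∈ D, W b - W a = ∫ x in a..b, w x) {a b : ℝ} (ha : a ∈ D) (hb : b ∈ D)
    (hab : a ≤ b) : ∫⁻ x in Ioc a b, ENNReal.ofReal (w x) = ENNReal.ofReal (W b - W a) := by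
  rw [hW a ha b hb, intervalIntegral.integral_of_le hab, ofReal_integral_eq_lintegral_ofReal
    (hint a ha b hb).1 ((ae_pos_Ioc hD hpos ha hb).mono fun x hx => hx.le)]

/-- The monotone map `W` pulls `Ioc (W a) (W b)` back to `Ioc a b`, whose mass is `W b - W a`. Hence
the two measures agree on all such intervals. Those with rational `a`, `b` are countably many and
cover the image, and equality on each of them suffices. -/
theorem map_withDensity_of_primitive (hD : IsOpenInterval D)
    (hpos : ∀ᵐ x ∂volume.restrict D, 0 < w x)
    (hint : ∀ a ∈ D, ∀ b ∈ D, IntervalIntegrable w volume a b)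
    (hW : ∀ a ∈ D, ∀ b ∈ D, W b - W a = ∫ x in a..b, w x) :
    Measure.map W ((volume.restrict D).withDensity fun x => ENNReal.ofReal (w x)) =
      volume.restrict (W '' D) := by
  have hm := strictMonoOn_of_primitive hD hpos hint hW
  have hc := continuousOn_of_primitive hD hint hW
  have hE := image_isOpenInterval hD hm hc
  set ρ := (volume.restrict D).withDensity fun x => ENNReal.ofReal (w x) with hρ
  have hρD : ρ ≪ volume.restrict D := withDensity_absolutelyContinuous _ _
  have hWm : AEMeasurable W ρ := (hc.aemeasurable hD.isOpen.measurableSet).mono_ac hρD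
  have hρm : ∀ s, MeasurableSet s → ρ s = ∫⁻ x in s ∩ D, ENNReal.ofReal (w x) := fun s hs => by
    rw [hρ, withDensity_apply _ hs, Measure.restrict_restrict hs]
  set ν := Measure.map W ρ with hν
  have hIoc : ∀ a ∈ D, ∀ b ∈ D, a ≤ b → ν (Ioc (W a) (W b)) = ENNReal.ofReal (W b - W a) := by
    intro a ha b hb hab
    have : W ⁻¹' Ioc (W a) (W b) =ᵐ[ρ] Ioc a b := by
      have hmem : ∀ᵐ x ∂ρ, x ∈ D := hρD.ae_le (ae_restrict_mem hD.isOpen.measurableSet)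
      filter_upwards [hmem] with x hx
      refine propext ?_
      change W a < W x ∧ W x ≤ W b ↔ a < x ∧ x ≤ b
      rw [hm.lt_iff_lt ha hx, hm.le_iff_le hx hb]
    rw [hν, Measure.map_apply_of_aemeasurable hWm measurableSet_Ioc, measure_congr this,
      hρm _ measurableSet_Ioc, inter_eq_left.2 (hD.Ioc_subset ha hb),
      lintegral_Ioc_of_primitive hD hpos hint hW ha hb hab]
  let ι := {p : ℚ × ℚ // (p.1 : ℝ) ∈ D ∧ (p.2 : ℝ) ∈ D}
  let s : ι → Set ℝ := fun p => Ioc (W p.1.1) (W p.1.2)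
  have hs : ⋃ i, s i = W '' D := by
    apply subset_antisymm
    · refine iUnion_subset fun i => ?_
      exact hE.Ioc_subset (mem_image_of_mem _ i.2.1) (mem_image_of_mem _ i.2.2)
    · rintro _ ⟨x, hx, rfl⟩
      obtain ⟨a, ha, hax⟩ := hD.exists_lt hx
      obtain ⟨b, hb, hxb⟩ := hD.exists_gt hx
      obtain ⟨c, hac, hcx⟩ := exists_rat_btwn hax
      obtain ⟨d, hxd, hdb⟩ := exists_rat_btwn hxb
      have hcD := hD.ordConnected.out ha hx ⟨hac.le, hcx.le⟩
      have hdD := hD.ordConnected.out hx hb ⟨hxd.le, hdb.le⟩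
      exact mem_iUnion.2 ⟨⟨(c, d), hcD, hdD⟩, hm hcD hx hcx, (hm hx hdD hxd).le⟩
  have key : ν.restrict (⋃ i, s i) = volume.restrict (⋃ i, s i) := by
    rw [Measure.restrict_iUnion_congr]
    rintro ⟨⟨c, d⟩, hc', hd'⟩
    simp only at hc' hd'
    change ν.restrict (Ioc (W c) (W d)) = volume.restrict (Ioc (W c) (W d))
    symm
    have hval : ∀ a b : ℝ, volume.restrict (Ioc (W c) (W d)) (Ioc a b) =
        ν.restrict (Ioc (W c) (W d)) (Ioc a b) := by
      intro a b
      rw [Measure.restrict_apply measurableSet_Ioc, Measure.restrict_apply measurableSet_Ioc,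
        Ioc_inter_Ioc]
      by_cases hlt : a ⊔ W c < b ⊓ W d
      · have hA : a ⊔ W c ∈ W '' D := hE.ordConnected.out (mem_image_of_mem W hc')
          (mem_image_of_mem W hd') ⟨le_sup_right, hlt.le.trans inf_le_right⟩
        have hB : b ⊓ W d ∈ W '' D := hE.ordConnected.out (mem_image_of_mem W hc')
          (mem_image_of_mem W hd') ⟨le_sup_right.trans hlt.le, inf_le_right⟩
        obtain ⟨a', ha', hA'⟩ := hA
        obtain ⟨b', hb', hB'⟩ := hB
        rw [← hA', ← hB'] at hlt ⊢
        rw [hIoc a' ha' b' hb' ((hm.lt_iff_lt ha' hb').1 hlt).le, Real.volume_Ioc]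
      · rw [Ioc_eq_empty hlt]; simp
    refine Measure.ext_of_Ioc' _ _ (fun a b _ => ?_) fun a b _ => hval a b
    exact ((Measure.restrict_apply_le _ _).trans_lt (by simp)).ne
  rw [hs] at key
  rw [← key, Measure.restrict_eq_self_of_ae_mem]
  refine (ae_map_iff (p := fun x => x ∈ W '' D) hWm hE.isOpen.measurableSet).2 ?_
  filter_upwards [hρD.ae_le (ae_restrict_mem hD.isOpen.measurableSet)] with x hx
  exact mem_image_of_mem _ hx

/-- Since `w > 0` almost everywhere, the measure with density `w` has the same null sets as Lebesgue
measure on `D`. Restricted to the subtype of `D`, the map `W` is a measurable embedding, so the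
transport formulas hold for functions that need not be measurable. -/
theorem changeOfVar_of_primitive (hD : IsOpenInterval D)
    (hw : AEMeasurable w (volume.restrict D)) (hpos : ∀ᵐ x ∂volume.restrict D, 0 < w x)
    (hint : ∀ a ∈ D, ∀ b ∈ D, IntervalIntegrable w volume a b)
    (hW : ∀ a ∈ D, ∀ b ∈ D, W b - W a = ∫ x in a..b, w x) :
    ChangeOfVar W D w (W '' D) fun _ => 1 := by
  have hm := strictMonoOn_of_primitive hD hpos hint hW
  have hc := continuousOn_of_primitive hD hint hW
  have hDm := hD.isOpen.measurableSet
  have hw' : AEMeasurable (fun x => ENNReal.ofReal (w x)) (volume.restrict D) := hw.ennreal_ofReal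
  have hmap := map_withDensity_of_primitive hD hpos hint hW
  set ρ := (volume.restrict D).withDensity fun x => ENNReal.ofReal (w x) with hρ
  have hρD : ρ ≪ volume.restrict D := withDensity_absolutelyContinuous _ _
  have hDρ : volume.restrict D ≪ ρ := withDensity_absolutelyContinuous' hw' <| by
    filter_upwards [hpos] with x hx
    simpa using hx
  have hρr : ρ.restrict D = ρ := by
    rw [hρ, restrict_withDensity hDm, Measure.restrict_restrict hDm, inter_self]
  have hWm : AEMeasurable W ρ := (hc.aemeasurable hDm).mono_ac hρD
  have hemb : MeasurableEmbedding (D.domRestrict W) := hc.measurableEmbedding hDm hm.injOn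
  have hval := MeasurableEmbedding.subtype_coe hDm
  have hmap' : Measure.map (D.domRestrict W) (Measure.comap Subtype.val ρ) =
      volume.restrict (W '' D) := by
    rw [← hmap]
    conv_rhs => rw [← hρr, ← map_comap_subtype_coe hDm]
    rw [AEMeasurable.map_map_of_aemeasurable _ measurable_subtype_coe.aemeasurable]
    · rfl
    · rwa [map_comap_subtype_coe hDm, hρr]
  refine ⟨hm.injOn.bijOn_image, fun φ => ?_, fun φ => ?_, fun P => ?_⟩
  · simp only [ENNReal.ofReal_one, mul_one]
    rw [← hmap', hemb.lintegral_map]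
    change ∫⁻ a : D, (fun x => φ (W x)) a ∂_ = _
    rw [← hval.lintegral_map (μ := Measure.comap Subtype.val ρ) (fun x => φ (W x)),
      map_comap_subtype_coe hDm, hρr, hρ,
      lintegral_withDensity_eq_lintegral_mul_non_measurable₀ _ hw' (by simp)]
    simp only [Pi.mul_apply, mul_comm]
  · rw [← hmap', hemb.aemeasurable_map_iff]
    change AEMeasurable ((fun x => φ (W x)) ∘ Subtype.val) _ ↔ _
    rw [← hval.aemeasurable_map_iff, map_comap_subtype_coe hDm, hρr]
    exact ⟨fun h => h.mono_ac hDρ, fun h => h.mono_ac hρD⟩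
  · rw [← hmap', hemb.ae_map_iff]
    change (∀ᵐ x : D ∂_, (fun x => P (W x)) x) ↔ _
    rw [← hval.ae_map_iff (p := fun x => P (W x)) (μ := Measure.comap Subtype.val ρ),
      map_comap_subtype_coe hDm, hρr]
    exact ⟨fun h => hDρ.ae_le h, fun h => hρD.ae_le h⟩

end Primitive

/-! ### Composition, inversion and reweighting of changes of variable. -/

namespace ChangeOfVar

variable {Θ Ξ : ℝ → ℝ} {D E F : Set ℝ} {w w' v v' u : ℝ → ℝ}

theorem comp (h₂ : ChangeOfVar Ξ E v F u) (h₁ : ChangeOfVar Θ D w E v) :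
    ChangeOfVar (Ξ ∘ Θ) D w F u :=
  ⟨h₂.bijOn.comp h₁.bijOn, fun φ => (h₂.lintegral_eq φ).trans (h₁.lintegral_eq _),
    fun φ => (h₂.aemeasurable_iff φ).trans (h₁.aemeasurable_iff _),
    fun P => (h₂.ae_iff P).trans (h₁.ae_iff _)⟩

theorem congr_map (h : ChangeOfVar Θ D w E v) (hD : MeasurableSet D) (he : EqOn Θ Ξ D) :
    ChangeOfVar Ξ D w E v := by
  have hae : ∀ᵐ x ∂volume.restrict D, Θ x = Ξ x := by
    filter_upwards [ae_restrict_mem hD] with x hx using he hx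
  refine ⟨h.bijOn.congr he, fun φ => ?_, fun φ => ?_, fun P => ?_⟩
  · rw [h.lintegral_eq]
    exact lintegral_congr_ae (hae.mono fun x hx => by simp only [hx])
  · rw [h.aemeasurable_iff]
    exact aemeasurable_congr (hae.mono fun x hx => by simp only [hx])
  · rw [h.ae_iff]
    exact Filter.eventually_congr (hae.mono fun x hx => by simp only [hx])

theorem symm (h : ChangeOfVar Θ D w E v) (hD : MeasurableSet D)
    (hl : ∀ x ∈ D, Ξ (Θ x) = x) : ChangeOfVar Ξ E v D w := by
  have hl' : ∀ᵐ x ∂volume.restrict D, Ξ (Θ x) = x := by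
    filter_upwards [ae_restrict_mem hD] with x hx using hl x hx
  refine ⟨?_, fun φ => ?_, fun φ => ?_, fun P => ?_⟩
  · have hi : InvOn Θ Ξ E D := by
      refine ⟨?_, fun x hx => hl x hx⟩
      intro t ht
      obtain ⟨x, hx, rfl⟩ := h.bijOn.surjOn ht
      rw [hl x hx]
    refine hi.bijOn ?_ h.bijOn.mapsTo
    intro t ht
    obtain ⟨x, hx, rfl⟩ := h.bijOn.surjOn ht
    rwa [hl x hx]
  · rw [h.lintegral_eq fun t => φ (Ξ t)]
    exact lintegral_congr_ae (hl'.mono fun x hx => by simp only [hx])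
  · rw [h.aemeasurable_iff fun t => φ (Ξ t)]
    exact (aemeasurable_congr (hl'.mono fun x hx => by simp only [hx])).symm
  · rw [h.ae_iff fun t => P (Ξ t)]
    exact Filter.eventually_congr (hl'.mono fun x hx => by simp only [hx])

theorem symm_invFunOn (h : ChangeOfVar Θ D w E v) (hD : MeasurableSet D) :
    ChangeOfVar (Function.invFunOn Θ D) E v D w :=
  h.symm hD fun _ hx => h.bijOn.injOn.leftInvOn_invFunOn hx

/-- If two changes of variable have the same target, so does their quotient. -/
theorem of_comp_eq {N C Ψ : ℝ → ℝ} {D' : Set ℝ} (hN : ChangeOfVar N D w E v)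
    (hC : ChangeOfVar C D' w' E v) (hD : MeasurableSet D) (hD' : MeasurableSet D')
    (hmaps : MapsTo Ψ D' D) (heq : ∀ x ∈ D', N (Ψ x) = C x) :
    ChangeOfVar Ψ D' w' D w := by
  refine ((hN.symm_invFunOn hD).comp hC).congr_map hD' fun x hx => ?_
  change Function.invFunOn N D (C x) = Ψ x
  rw [← heq x hx]
  exact hN.bijOn.injOn.leftInvOn_invFunOn (hmaps hx)

/-- Multiplying both densities by corresponding nonnegative functions. -/
theorem of_ratio (h : ChangeOfVar Θ D w E v) (hv : ∀ᵐ x ∂volume.restrict D, 0 < v (Θ x))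
    (hv' : ∀ᵐ x ∂volume.restrict D, 0 ≤ v' (Θ x))
    (hr : ∀ᵐ x ∂volume.restrict D, w' x * v (Θ x) = v' (Θ x) * w x) :
    ChangeOfVar Θ D w' E v' := by
  refine ⟨h.bijOn, fun φ => ?_, h.aemeasurable_iff, h.ae_iff⟩
  have h1 : ∫⁻ t in E, φ t * ENNReal.ofReal (v' t) =
      ∫⁻ t in E, φ t * ENNReal.ofReal (v' t / v t) * ENNReal.ofReal (v t) := by
    refine lintegral_congr_ae ((h.ae_iff _).2 ?_)
    filter_upwards [hv, hv'] with x hx hx'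
    rw [mul_assoc, ← ENNReal.ofReal_mul (by positivity), div_mul_cancel₀ _ hx.ne']
  rw [h1, h.lintegral_eq fun t => φ t * ENNReal.ofReal (v' t / v t)]
  refine lintegral_congr_ae ?_
  filter_upwards [hv, hv', hr] with x hx hx' hxr
  rw [mul_assoc, ← ENNReal.ofReal_mul (by positivity), div_mul_eq_mul_div, ← hxr,
    mul_div_cancel_right₀ _ hx.ne']

theorem setLIntegral_eq (h : ChangeOfVar Θ D w E v) (hD : MeasurableSet D)
    {S T : Set ℝ} (hS : MeasurableSet S) (hT : MeasurableSet T)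
    (hST : ∀ x ∈ D, Θ x ∈ T ↔ x ∈ S) (φ : ℝ → ℝ≥0∞) :
    ∫⁻ t in E ∩ T, φ t * ENNReal.ofReal (v t) =
      ∫⁻ x in D ∩ S, φ (Θ x) * ENNReal.ofReal (w x) := by
  have h1 := h.lintegral_eq (T.indicator φ)
  have h2 : ∀ t, T.indicator φ t * ENNReal.ofReal (v t) =
      T.indicator (fun t => φ t * ENNReal.ofReal (v t)) t := fun t => by
    by_cases ht : t ∈ T <;> simp [ht]
  have h3 : ∫⁻ x in D, T.indicator φ (Θ x) * ENNReal.ofReal (w x) =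
      ∫⁻ x in D, S.indicator (fun x => φ (Θ x) * ENNReal.ofReal (w x)) x := by
    refine setLIntegral_congr_fun hD fun x hx => ?_
    by_cases hs : x ∈ S
    · simp [hs, (hST x hx).2 hs]
    · have : Θ x ∉ T := fun h => hs ((hST x hx).1 h)
      simp [hs, this]
  simp only [h2] at h1
  rw [h3, lintegral_indicator hT, lintegral_indicator hS, Measure.restrict_restrict hT,
    Measure.restrict_restrict hS, inter_comm T, inter_comm S] at h1
  exact h1

end ChangeOfVar

/-! ### Decreasing primitives, anchored primitives and distribution functions. -/

theorem changeOfVar_neg (E : Set ℝ) :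
    ChangeOfVar (fun x => -x) (Neg.neg ⁻¹' E) (fun _ => 1) E fun _ => 1 := by
  have hmp : MeasurePreserving (Neg.neg : ℝ → ℝ) := Measure.measurePreserving_neg volume
  have hemb : MeasurableEmbedding (Neg.neg : ℝ → ℝ) := (MeasurableEquiv.neg ℝ).measurableEmbedding
  have hr := hmp.restrict_preimage_emb hemb E
  refine ⟨⟨fun x hx => hx, neg_injective.injOn, fun x hx => ⟨-x, by simpa using hx, by simp⟩⟩,
    fun φ => ?_, fun φ => ?_, fun P => ?_⟩
  · simp only [ENNReal.ofReal_one, mul_one]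
    exact (hr.lintegral_comp_emb hemb φ).symm
  · rw [← hr.map_eq, hemb.aemeasurable_map_iff]; rfl
  · rw [← hr.map_eq, hemb.ae_map_iff]

theorem IsOpenInterval.neg {E : Set ℝ} (hE : IsOpenInterval E) :
    IsOpenInterval (Neg.neg ⁻¹' E) := by
  refine ⟨hE.isOpen.preimage continuous_neg, ⟨fun x hx y hy z hz => ?_⟩⟩
  exact hE.ordConnected.out hy hx ⟨neg_le_neg hz.2, neg_le_neg hz.1⟩

section Primitive

variable {D : Set ℝ} {w W : ℝ → ℝ}

/-- The change of variable given by a decreasing primitive. -/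
theorem changeOfVar_of_neg_primitive (hD : IsOpenInterval D)
    (hw : AEMeasurable w (volume.restrict D)) (hpos : ∀ᵐ x ∂volume.restrict D, 0 < w x)
    (hint : ∀ a ∈ D, ∀ b ∈ D, IntervalIntegrable w volume a b)
    (hW : ∀ a ∈ D, ∀ b ∈ D, W a - W b = ∫ x in a..b, w x) :
    StrictAntiOn W D ∧ IsOpenInterval (W '' D) ∧ ChangeOfVar W D w (W '' D) fun _ => 1 := by
  have hW' : ∀ a ∈ D, ∀ b ∈ D, (fun x => -W x) b - (fun x => -W x) a = ∫ x in a..b, w x :=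
    fun a ha b hb => by rw [← hW a ha b hb]; ring
  have hm := strictMonoOn_of_primitive hD hpos hint hW'
  have hc := continuousOn_of_primitive hD hint hW'
  have hI := image_isOpenInterval hD hm hc
  have hcv := changeOfVar_of_primitive hD hw hpos hint hW'
  have him : (fun x => -W x) '' D = Neg.neg ⁻¹' (W '' D) := by
    ext t; simp only [mem_image, mem_preimage, neg_eq_iff_eq_neg]
  have him' : W '' D = Neg.neg ⁻¹' ((fun x => -W x) '' D) := by
    rw [him, ← preimage_comp]; ext; simp
  refine ⟨fun a ha b hb hab => by simpa using hm ha hb hab, ?_, ?_⟩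
  · rw [him']; exact hI.neg
  · rw [him] at hcv
    have := (changeOfVar_neg (W '' D)).comp hcv
    exact this.congr_map hD.isOpen.measurableSet fun x _ => by simp

theorem inter_Iio_eq_union (hD : IsOpenInterval D) {a b : ℝ} (ha : a ∈ D) (hb : b ∈ D)
    (hab : a ≤ b) : D ∩ Iio b = D ∩ Iio a ∪ Ico a b := by
  ext x
  constructor
  · rintro ⟨hx, hxb⟩
    rcases lt_or_ge x a with h | h
    · exact Or.inl ⟨hx, h⟩
    · exact Or.inr ⟨h, hxb⟩
  · rintro (⟨hx, hxa⟩ | ⟨hax, hxb⟩)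
    · exact ⟨hx, lt_of_lt_of_le hxa hab⟩
    · exact ⟨hD.ordConnected.out ha hb ⟨hax, hxb.le⟩, hxb⟩

theorem inter_Ioi_eq_union (hD : IsOpenInterval D) {a b : ℝ} (ha : a ∈ D) (hb : b ∈ D)
    (hab : a ≤ b) : D ∩ Ioi a = Ioc a b ∪ D ∩ Ioi b := by
  ext x
  constructor
  · rintro ⟨hx, hxa⟩
    rcases le_or_gt x b with h | h
    · exact Or.inl ⟨hxa, h⟩
    · exact Or.inr ⟨hx, h⟩
  · rintro (⟨hax, hxb⟩ | ⟨hx, hxb⟩)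
    · exact ⟨hD.ordConnected.out ha hb ⟨hax.le, hxb⟩, hax⟩
    · exact ⟨hx, lt_of_le_of_lt hab hxb⟩

theorem setIntegral_Iio_sub (hD : IsOpenInterval D)
    (hfin : ∀ z ∈ D, IntegrableOn w (D ∩ Iio z)) (a : ℝ) (ha : a ∈ D) (b : ℝ) (hb : b ∈ D) :
    (∫ t in D ∩ Iio b, w t) - (∫ t in D ∩ Iio a, w t) = ∫ x in a..b, w x := by
  wlog hab : a ≤ b generalizing a b
  · rw [intervalIntegral.integral_symm, ← this b hb a ha (le_of_not_ge hab)]; ring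
  have hu := inter_Iio_eq_union hD ha hb hab
  have hi : IntegrableOn w (Ico a b) := (hfin b hb).mono_set (hu ▸ subset_union_right)
  rw [hu, setIntegral_union _ measurableSet_Ico (hfin a ha) hi, add_sub_cancel_left,
    integral_Ico_eq_integral_Ioc, intervalIntegral.integral_of_le hab]
  exact disjoint_left.2 fun x hx hx' => (not_lt.2 hx'.1) hx.2

theorem setIntegral_Ioi_sub (hD : IsOpenInterval D)
    (hfin : ∀ z ∈ D, IntegrableOn w (D ∩ Ioi z)) (a : ℝ) (ha : a ∈ D) (b : ℝ) (hb : b ∈ D) :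
    (∫ t in D ∩ Ioi a, w t) - (∫ t in D ∩ Ioi b, w t) = ∫ x in a..b, w x := by
  wlog hab : a ≤ b generalizing a b
  · rw [intervalIntegral.integral_symm, ← this b hb a ha (le_of_not_ge hab)]; ring
  have hu := inter_Ioi_eq_union hD ha hb hab
  have hi : IntegrableOn w (Ioc a b) := (hfin a ha).mono_set (hu ▸ subset_union_left)
  rw [hu, setIntegral_union _ (hD.isOpen.measurableSet.inter measurableSet_Ioi) hi (hfin b hb),
    add_sub_cancel_right, intervalIntegral.integral_of_le hab]
  exact disjoint_left.2 fun x hx hx' => (not_lt.2 hx.2) hx'.2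

theorem basePoint_mem (hne : D.Nonempty) : LineDensity.basePoint D ∈ D :=
  Classical.epsilon_spec hne

theorem primitiveFromLeft_sub (hD : IsOpenInterval D)
    (hint : ∀ a ∈ D, ∀ b ∈ D, IntervalIntegrable w volume a b) (a : ℝ) (ha : a ∈ D) (b : ℝ)
    (hb : b ∈ D) : LineDensity.primitiveFromLeft D w b - LineDensity.primitiveFromLeft D w a =
      ∫ x in a..b, w x := by
  unfold LineDensity.primitiveFromLeft
  split_ifs with h
  · exact setIntegral_Iio_sub hD h a ha b hb
  · have h0 := basePoint_mem ⟨a, ha⟩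
    exact intervalIntegral.integral_interval_sub_left (hint _ h0 _ hb) (hint _ h0 _ ha)

theorem primitiveFromRight_sub (hD : IsOpenInterval D)
    (hint : ∀ a ∈ D, ∀ b ∈ D, IntervalIntegrable w volume a b) (a : ℝ) (ha : a ∈ D) (b : ℝ)
    (hb : b ∈ D) : LineDensity.primitiveFromRight D w a - LineDensity.primitiveFromRight D w b =
      ∫ x in a..b, w x := by
  unfold LineDensity.primitiveFromRight
  split_ifs with h
  · exact setIntegral_Ioi_sub hD h a ha b hb
  · have h0 := basePoint_mem ⟨a, ha⟩
    rw [sub_eq_iff_eq_add, intervalIntegral.integral_add_adjacent_intervals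
      (hint _ ha _ hb) (hint _ hb _ h0)]

theorem intervalIntegrable_of_Iio (hD : IsOpenInterval D)
    (hfin : ∀ z ∈ D, IntegrableOn w (D ∩ Iio z)) (a : ℝ) (ha : a ∈ D) (b : ℝ) (hb : b ∈ D) :
    IntervalIntegrable w volume a b := by
  wlog hab : a ≤ b generalizing a b
  · exact (this b hb a ha (le_of_not_ge hab)).symm
  rw [intervalIntegrable_iff_integrableOn_Ico_of_le hab]
  exact (hfin b hb).mono_set (inter_Iio_eq_union hD ha hb hab ▸ subset_union_right)

/-- An open interval `E ⊆ (0, ∞)` such that `E ∩ (-∞, t)` has length `t ∈ E` starts at `0`. -/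
theorem inter_Iio_eq_Ioo {E : Set ℝ} (hE : IsOpenInterval E) (h0 : E ⊆ Ioi 0) {t : ℝ}
    (hvol : volume (E ∩ Iio t) = ENNReal.ofReal t) (ht : t ∈ E) : E ∩ Iio t = Ioo 0 t := by
  apply subset_antisymm fun x hx => ⟨h0 hx.1, hx.2⟩
  intro s hs
  refine ⟨?_, hs.2⟩
  by_contra hsE
  have hsub : E ∩ Iio t ⊆ Ioo s t := by
    intro x hx
    refine ⟨?_, hx.2⟩
    by_contra hxs
    exact hsE (hE.ordConnected.out hx.1 ht ⟨not_lt.1 hxs, hs.2.le⟩)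
  have := measure_mono (μ := volume) hsub
  rw [hvol, Real.volume_Ioo, ENNReal.ofReal_le_ofReal_iff (by linarith [hs.2])] at this
  linarith [hs.1]

/-- The primitive which vanishes at the left end of the interval. -/
theorem changeOfVar_cumulative (hD : IsOpenInterval D)
    (hw : AEMeasurable w (volume.restrict D)) (hpos : ∀ᵐ x ∂volume.restrict D, 0 < w x)
    (hfin : ∀ z ∈ D, IntegrableOn w (D ∩ Iio z)) (hW : ∀ x, W x = ∫ t in D ∩ Iio x, w t) :
    StrictMonoOn W D ∧ IsOpenInterval (W '' D) ∧ (ChangeOfVar W D w (W '' D) fun _ => 1) ∧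
      W '' D ⊆ Ioi 0 ∧ ∀ t ∈ W '' D, W '' D ∩ Iio t = Ioo 0 t := by
  have hint := intervalIntegrable_of_Iio hD hfin
  have hsub : ∀ a ∈ D, ∀ b ∈ D, W b - W a = ∫ x in a..b, w x := fun a ha b hb => by
    rw [hW, hW]; exact setIntegral_Iio_sub hD hfin a ha b hb
  have hm := strictMonoOn_of_primitive hD hpos hint hsub
  have hI := image_isOpenInterval hD hm (continuousOn_of_primitive hD hint hsub)
  have hcv := changeOfVar_of_primitive hD hw hpos hint hsub
  have hnn : ∀ x, ∀ᵐ t ∂volume.restrict (D ∩ Iio x), 0 ≤ w t := fun x =>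
    (ae_restrict_of_ae_restrict_of_subset inter_subset_left hpos).mono fun _ h => h.le
  have h0 : W '' D ⊆ Ioi 0 := by
    rintro _ ⟨x, hx, rfl⟩
    obtain ⟨a, ha, hax⟩ := hD.exists_lt hx
    have h1 : 0 ≤ W a := by rw [hW]; exact integral_nonneg_of_ae (hnn a)
    exact h1.trans_lt (hm ha hx hax)
  refine ⟨hm, hI, hcv, h0, ?_⟩
  rintro _ ⟨x, hx, rfl⟩
  -- The part of the image below `W x` has length `W x`, which leaves no gap above `0`.
  refine inter_Iio_eq_Ioo hI h0 ?_ (mem_image_of_mem W hx)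
  have := hcv.setLIntegral_eq hD.isOpen.measurableSet
    (S := Iio x) (T := Iio (W x)) measurableSet_Iio measurableSet_Iio
    (fun y hy => hm.lt_iff_lt hy hx) fun _ => 1
  simp only [ENNReal.ofReal_one, mul_one, one_mul, lintegral_const, Measure.restrict_apply,
    MeasurableSet.univ, univ_inter] at this
  rw [this, hW, ofReal_integral_eq_lintegral_ofReal (hfin x hx) (hnn x)]

theorem integrableOn_of_lintegral_ne_top {S : Set ℝ} (hw : AEMeasurable w (volume.restrict S))
    (hpos : ∀ᵐ x ∂volume.restrict S, 0 ≤ w x)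
    (hfin : ∫⁻ x in S, ENNReal.ofReal (w x) ≠ ⊤) : IntegrableOn w S :=
  ⟨hw.aestronglyMeasurable, (hasFiniteIntegral_iff_ofReal hpos).2 hfin.lt_top⟩

/-- The distribution function of a probability density maps onto the unit interval. -/
theorem changeOfVar_cdf (hD : IsOpenInterval D)
    (hw : AEMeasurable w (volume.restrict D)) (hpos : ∀ᵐ x ∂volume.restrict D, 0 < w x)
    (hmass : ∫⁻ x in D, ENNReal.ofReal (w x) = 1) (hW : ∀ x, W x = ∫ t in D ∩ Iio x, w t) :
    StrictMonoOn W D ∧ ChangeOfVar W D w (Ioo 0 1) fun _ => 1 := by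
  have hnn : ∀ᵐ t ∂volume.restrict D, 0 ≤ w t := hpos.mono fun _ h => h.le
  have hI : IntegrableOn w D := integrableOn_of_lintegral_ne_top hw hnn (by simp [hmass])
  obtain ⟨hm, hIm, hcv, h0, hlt⟩ := changeOfVar_cumulative hD hw hpos
    (fun z _ => hI.mono_set inter_subset_left) hW
  have hle : ∀ x, W x ≤ 1 := fun x => by
    have h1 : ∫ t in D, w t = 1 := by
      rw [integral_eq_lintegral_of_nonneg_ae hnn hI.1, hmass, ENNReal.toReal_one]
    rw [hW, ← h1]
    exact setIntegral_mono_set hI hnn (Filter.Eventually.of_forall inter_subset_left)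
  have hvol : volume (W '' D) = 1 := by
    have := hcv.lintegral_eq fun _ => 1
    simpa [hmass] using this
  have him : W '' D = Ioo 0 1 := by
    apply subset_antisymm
    · rintro _ ⟨x, hx, rfl⟩
      obtain ⟨b, hb, hxb⟩ := hD.exists_gt hx
      exact ⟨h0 (mem_image_of_mem W hx), (hm hx hb hxb).trans_le (hle b)⟩
    · intro s hs
      by_cases hex : ∃ t ∈ W '' D, s < t
      · obtain ⟨t, ht, hst⟩ := hex
        exact ((hlt t ht).symm ▸ (⟨hs.1, hst⟩ : s ∈ Ioo 0 t) : s ∈ W '' D ∩ Iio t).1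
      · push Not at hex
        -- Otherwise the image, of length `1`, would fit into an interval of length `s < 1`.
        have hsub : W '' D ⊆ Ioc 0 s := fun t ht => ⟨h0 ht, hex t ht⟩
        have := measure_mono (μ := volume) hsub
        rw [hvol, Real.volume_Ioc, ENNReal.one_le_ofReal] at this
        linarith [hs.2]
  rw [him] at hcv
  exact ⟨hm, hcv⟩

end Primitive

theorem setIntegral_pos_of_ae_pos {D : Set ℝ} {w : ℝ → ℝ} (hD : IsOpen D) (hne : D.Nonempty)
    (hw : IntegrableOn w D) (hpos : ∀ᵐ x ∂volume.restrict D, 0 < w x) : 0 < ∫ x in D, w x := by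
  rw [setIntegral_pos_iff_support_of_nonneg_ae (hpos.mono fun _ h => h.le) hw]
  have : D ≤ᵐ[volume] (Function.support w ∩ D : Set ℝ) := by
    rw [ae_restrict_iff' hD.measurableSet] at hpos
    filter_upwards [hpos] with x hx hm
    exact ⟨(hx hm).ne', hm⟩
  exact (hD.measure_pos volume hne).trans_le (measure_mono_ae this)

theorem intervalIntegrable_continuousOn_mul {D : Set ℝ} (hD : IsOpenInterval D) {c w : ℝ → ℝ}
    (hc : ContinuousOn c D) (hw : ∀ a ∈ D, ∀ b ∈ D, IntervalIntegrable w volume a b)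
    (a : ℝ) (ha : a ∈ D) (b : ℝ) (hb : b ∈ D) :
    IntervalIntegrable (fun x => c x * w x) volume a b :=
  (hw a ha b hb).continuousOn_mul (hc.mono (hD.uIcc_subset ha hb))

theorem IntegrableOn.intervalIntegrable_of_mem {D : Set ℝ} (hD : IsOpenInterval D) {w : ℝ → ℝ}
    (hw : IntegrableOn w D) (a : ℝ) (ha : a ∈ D) (b : ℝ) (hb : b ∈ D) :
    IntervalIntegrable w volume a b :=
  (hw.mono_set (hD.uIcc_subset ha hb)).intervalIntegrable

/-! ### The escort, up, inverse escort and divergence transformations as transports. -/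

namespace LineDensity

theorem IsPDF.isOpenInterval {f : LineDensity} (hf : f.IsPDF) : IsOpenInterval f.dom :=
  ⟨hf.isOpen, hf.ordConnected⟩

theorem IsPDF.ae_pos {f : LineDensity} (hf : f.IsPDF) :
    ∀ᵐ x ∂volume.restrict f.dom, 0 < f.val x := by
  filter_upwards [ae_restrict_mem hf.isOpen.measurableSet] with x hx using hf.pos x hx

theorem IsPDF.nonempty {f : LineDensity} (hf : f.IsPDF) : f.dom.Nonempty := by
  by_contra h
  have := hf.mass
  rw [not_nonempty_iff_eq_empty.1 h] at this
  simp at this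

theorem IsPDF.cdf_spec {h : LineDensity} (hh : h.IsPDF) :
    StrictMonoOn (cdf h) h.dom ∧ ChangeOfVar (cdf h) h.dom h.val (Ioo 0 1) fun _ => 1 :=
  changeOfVar_cdf hh.isOpenInterval hh.aemeasurable hh.ae_pos hh.mass fun _ => rfl

/-- The escort transformation, for an arbitrary primitive. -/
theorem changeOfVar_relEscort {α : ℝ} {h f : LineDensity} (hD : IsOpenInterval f.dom)
    (hf : ∀ᵐ x ∂volume.restrict f.dom, 0 < f.val x)
    (hh : ∀ᵐ x ∂volume.restrict f.dom, 0 < h.val x)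
    (hcv : ChangeOfVar (escortVar α h f) f.dom (fun t => f.val t ^ (1 - α) * h.val t ^ α)
      (relEscort α h f).dom fun _ => 1) :
    (∀ x ∈ f.dom, (relEscort α h f).val (escortVar α h f x) = (f.val x / h.val x) ^ α) ∧
      ChangeOfVar (escortVar α h f) f.dom f.val (relEscort α h f).dom (relEscort α h f).val := by
  have hval : ∀ x ∈ f.dom,
      (relEscort α h f).val (escortVar α h f x) = (f.val x / h.val x) ^ α := fun x hx => by
    simp only [relEscort]
    rw [hcv.bijOn.injOn.leftInvOn_invFunOn hx]
  refine ⟨hval, hcv.of_ratio (by simp) ?_ ?_⟩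
  · filter_upwards [hf, hh, ae_restrict_mem hD.isOpen.measurableSet] with x h1 h2 hx
    rw [hval x hx]; positivity
  · filter_upwards [hf, hh, ae_restrict_mem hD.isOpen.measurableSet] with x h1 h2 hx
    rw [hval x hx, Real.div_rpow h1.le h2.le, Real.rpow_sub h1, Real.rpow_one]
    have := (Real.rpow_pos_of_pos h1 α).ne'
    have := (Real.rpow_pos_of_pos h2 α).ne'
    field_simp

/-- Local integrability of the weight is enough here. The resulting additive constant in the
variable is harmless, because the down variable depends only on the values of the escort density. -/
theorem relEscort_spec {α : ℝ} {h f : LineDensity} (hD : IsOpenInterval f.dom)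
    (hfm : AEMeasurable f.val (volume.restrict f.dom))
    (hhm : AEMeasurable h.val (volume.restrict f.dom))
    (hf : ∀ᵐ x ∂volume.restrict f.dom, 0 < f.val x)
    (hh : ∀ᵐ x ∂volume.restrict f.dom, 0 < h.val x)
    (hint : ∀ a ∈ f.dom, ∀ b ∈ f.dom,
      IntervalIntegrable (fun t => f.val t ^ (1 - α) * h.val t ^ α) volume a b) :
    StrictMonoOn (escortVar α h f) f.dom ∧ IsOpenInterval (relEscort α h f).dom ∧
      (∀ x ∈ f.dom, (relEscort α h f).val (escortVar α h f x) = (f.val x / h.val x) ^ α) ∧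
      ChangeOfVar (escortVar α h f) f.dom f.val (relEscort α h f).dom (relEscort α h f).val := by
  have hpos : ∀ᵐ x ∂volume.restrict f.dom, 0 < f.val x ^ (1 - α) * h.val x ^ α := by
    filter_upwards [hf, hh] with x h1 h2
    positivity
  have hsub := primitiveFromLeft_sub hD hint
  have hm := strictMonoOn_of_primitive hD hpos hint hsub
  have hcv := changeOfVar_of_primitive hD ((hfm.pow_const _).mul (hhm.pow_const _)) hpos hint hsub
  exact ⟨hm, image_isOpenInterval hD hm (continuousOn_of_primitive hD hint hsub),
    changeOfVar_relEscort hD hf hh hcv⟩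

/-- The up density at `u(t)` is the reciprocal of the factor of `g t` in `|u'(t)|`, hence mass is
preserved. On a domain inside `(0, ∞)` that factor is continuous, which makes the weight locally
integrable. -/
theorem up_spec {γ : ℝ} {g : LineDensity} (hγ : γ ≠ 2) (hD : IsOpenInterval g.dom)
    (h0 : g.dom ⊆ Ioi 0) (hgm : AEMeasurable g.val (volume.restrict g.dom))
    (hg : ∀ᵐ x ∂volume.restrict g.dom, 0 < g.val x) (hgi : IntegrableOn g.val g.dom) :
    StrictAntiOn (upVar γ g) g.dom ∧ IsOpenInterval (up γ g).dom ∧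
      (∀ t ∈ g.dom, (up γ g).val (upVar γ g t) = |(γ - 2) * t| ^ (1 / (2 - γ))) ∧
      ChangeOfVar (upVar γ g) g.dom g.val (up γ g).dom (up γ g).val := by
  have habs : ∀ t ∈ g.dom, 0 < |(γ - 2) * t| := fun t ht =>
    abs_pos.2 (mul_ne_zero (sub_ne_zero.2 hγ) (h0 ht).ne')
  have hc : ContinuousOn (fun t => |(γ - 2) * t| ^ (1 / (γ - 2))) g.dom := by
    refine ContinuousOn.rpow_const (by fun_prop) fun t ht => Or.inl (habs t ht).ne'
  have hint := intervalIntegrable_continuousOn_mul hD hc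
    (IntegrableOn.intervalIntegrable_of_mem hD hgi)
  have hmem := ae_restrict_mem (μ := volume) hD.isOpen.measurableSet
  have hpos : ∀ᵐ t ∂volume.restrict g.dom, 0 < |(γ - 2) * t| ^ (1 / (γ - 2)) * g.val t := by
    filter_upwards [hg, hmem] with t h1 ht
    have := habs t ht
    positivity
  obtain ⟨hanti, hI, hcv⟩ := changeOfVar_of_neg_primitive (W := upVar γ g) hD
    ((hc.aemeasurable hD.isOpen.measurableSet).mul hgm) hpos hint (primitiveFromRight_sub hD hint)
  have hval : ∀ t ∈ g.dom, (up γ g).val (upVar γ g t) = |(γ - 2) * t| ^ (1 / (2 - γ)) := by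
    intro t ht
    simp only [up]
    rw [hanti.injOn.leftInvOn_invFunOn ht]
  refine ⟨hanti, hI, hval, hcv.of_ratio (by simp) ?_ ?_⟩
  · filter_upwards [hmem] with t ht
    rw [hval t ht]; positivity
  · filter_upwards [hmem] with t ht
    change _ = _ * (|(γ - 2) * t| ^ (1 / (γ - 2)) * g.val t)
    rw [hval t ht, mul_one, ← mul_assoc, ← Real.rpow_add (habs t ht)]
    have : 1 / (2 - γ) + 1 / (γ - 2) = 0 := by
      rw [← neg_sub γ 2, one_div_neg_eq_neg_one_div, neg_add_cancel]
    rw [this, Real.rpow_zero, one_mul]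

-- The dilation is absorbed by taking `Ψ x = r * y(x)`. Then `Ψ` matches the distribution function
-- of `h` with that of the normalized weight `r ^ (-(1 / α)) * g ^ (1 - 1 / α)`. Only integrals from
-- the left end occur, so a translation of `g` does not matter.
open scoped Pointwise in
theorem invRelEscort_spec {α : ℝ} {h g : LineDensity} (hα : α ≠ 0) (hD : IsOpenInterval g.dom)
    (hne : g.dom.Nonempty) (hgm : AEMeasurable g.val (volume.restrict g.dom))
    (hg : ∀ᵐ x ∂volume.restrict g.dom, 0 < g.val x) (hadm : InverseAdmissible α g)
    (hh : h.IsPDF) :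
    ∃ (r : ℝ) (Ψ : ℝ → ℝ), 0 < r ∧ StrictMonoOn Ψ h.dom ∧
      ChangeOfVar Ψ h.dom h.val g.dom (fun t => r ^ (-(1 / α)) * g.val t ^ (1 - 1 / α)) ∧
      ∀ x, (invRelEscort α h g).val x = (r * g.val (Ψ x)) ^ (1 / α) * h.val x := by
  have hexp : (α - 1) / α = 1 - 1 / α := by rw [sub_div, div_self hα]
  have hDm := hD.isOpen.measurableSet
  unfold InverseAdmissible at hadm
  rw [hexp] at hadm
  have hpos : ∀ᵐ x ∂volume.restrict g.dom, 0 < g.val x ^ (1 - 1 / α) :=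
    hg.mono fun x hx => Real.rpow_pos_of_pos hx _
  set A := ∫ x in g.dom, g.val x ^ (1 - 1 / α) with hA
  have hA0 : 0 < A := setIntegral_pos_of_ae_pos hD.isOpen hne hadm hpos
  set r := inverseRatio α g with hr
  -- The exponent `1 / (1 - (1 - 1 / α))` is `α`; for `α = 1` the number `A` is the length of the
  -- interval. Thus `r` is exactly the constant giving the weight mass one.
  have hrA : r = A ^ α := by
    rw [hr, inverseRatio, renyiPower, hexp, ← hA]
    congr 1
    field_simp
    ring
  have hr0 : 0 < r := hrA ▸ Real.rpow_pos_of_pos hA0 _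
  have hrA' : r ^ (-(1 / α)) = A⁻¹ := by
    rw [hrA, ← Real.rpow_mul hA0.le, show α * -(1 / α) = -1 by field_simp, Real.rpow_neg_one]
  set w : ℝ → ℝ := fun t => r ^ (-(1 / α)) * g.val t ^ (1 - 1 / α) with hw
  have hwpos : ∀ᵐ x ∂volume.restrict g.dom, 0 < w x :=
    hpos.mono fun x hx => mul_pos (Real.rpow_pos_of_pos hr0 _) hx
  have hmass : ∫⁻ x in g.dom, ENNReal.ofReal (w x) = 1 := by
    rw [← ofReal_integral_eq_lintegral_ofReal (hadm.const_mul _) (hwpos.mono fun _ h => h.le),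
      integral_const_mul, ← hA, hrA', inv_mul_cancel₀ hA0.ne', ENNReal.ofReal_one]
  set N : ℝ → ℝ := fun s => ∫ t in g.dom ∩ Iio s, w t with hN
  obtain ⟨hNm, hNcv⟩ := changeOfVar_cdf (W := N) hD ((hgm.pow_const _).const_mul _) hwpos hmass
    fun _ => rfl
  obtain ⟨hCm, hCcv⟩ := hh.cdf_spec
  set k := scale r g with hk
  set W : ℝ → ℝ := fun y => ∫ t in k.dom ∩ Iio y, k.val t ^ (1 - 1 / α) with hW
  -- Substitution `t ↦ r * t` in the integral defining the implicit equation for `y`.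
  have hWN : ∀ y, W y = N (r * y) := by
    intro y
    have h1 := Measure.setIntegral_comp_smul_of_pos volume
      (fun t => (r * g.val t) ^ (1 - 1 / α)) (k.dom ∩ Iio y) hr0
    have h2 : r • (k.dom ∩ Iio y) = g.dom ∩ Iio (r * y) := by
      ext s
      rw [mem_smul_set_iff_inv_smul_mem₀ hr0.ne']
      simp only [hk, scale, mem_inter_iff, mem_ofPred_eq, smul_eq_mul, mem_Iio,
        mul_inv_cancel_left₀ hr0.ne', inv_mul_lt_iff₀ hr0]
    rw [h2] at h1
    simp only [smul_eq_mul, Module.finrank_self, pow_one] at h1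
    change ∫ t in k.dom ∩ Iio y, (r * g.val (r * t)) ^ (1 - 1 / α) = _
    rw [h1, ← integral_const_mul]
    refine integral_congr_ae ?_
    filter_upwards [ae_restrict_of_ae_restrict_of_subset inter_subset_left hg] with t ht
    simp only [hw]
    rw [Real.mul_rpow hr0.le ht.le, ← mul_assoc, Real.rpow_sub hr0, Real.rpow_one,
      Real.rpow_neg hr0.le]
    field_simp
  have hex : ∀ x ∈ h.dom, ∃ y ∈ k.dom, W y = cdf h x := by
    intro x hx
    obtain ⟨s, hs, hsx⟩ := hNcv.bijOn.surjOn (hCcv.bijOn.mapsTo hx)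
    refine ⟨r⁻¹ * s, ?_, ?_⟩
    · simpa [hk, scale, mul_inv_cancel_left₀ hr0.ne'] using hs
    · rw [hWN, mul_inv_cancel_left₀ hr0.ne', hsx]
  set Ψ : ℝ → ℝ := fun x => r * invEscortVar α h g x with hΨ
  have hmaps : MapsTo Ψ h.dom g.dom := fun x hx => Function.invFunOn_mem (hex x hx)
  have heq : ∀ x ∈ h.dom, N (Ψ x) = cdf h x := fun x hx => by
    rw [hΨ, ← hWN]
    exact Function.invFunOn_eq (hex x hx)
  refine ⟨r, Ψ, hr0, ?_, ?_, fun x => rfl⟩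
  · intro a ha b hb hab
    rw [← hNm.lt_iff_lt (hmaps ha) (hmaps hb), heq a ha, heq b hb]
    exact hCm ha hb hab
  · exact hNcv.of_comp_eq hCcv hDm hh.isOpen.measurableSet hmaps heq

/-- The density produced by the inverse escort transformation is transported to the original. -/
theorem changeOfVar_invRelEscort {α r : ℝ} {Ψ : ℝ → ℝ} {h g : LineDensity}
    (hg : ∀ᵐ x ∂volume.restrict g.dom, 0 < g.val x) (hr : 0 < r)
    (hcv : ChangeOfVar Ψ h.dom h.val g.dom (fun t => r ^ (-(1 / α)) * g.val t ^ (1 - 1 / α)))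
    (hval : ∀ x, (invRelEscort α h g).val x = (r * g.val (Ψ x)) ^ (1 / α) * h.val x) :
    ChangeOfVar Ψ h.dom (invRelEscort α h g).val g.dom g.val := by
  have hg' := (hcv.ae_iff _).1 hg
  refine hcv.of_ratio ?_ (hg'.mono fun _ h => h.le) ?_
  · filter_upwards [hg'] with x hx
    positivity
  · filter_upwards [hg'] with x hx
    rw [hval, Real.mul_rpow hr.le hx.le, Real.rpow_neg hr.le, Real.rpow_sub hx, Real.rpow_one]
    have := (Real.rpow_pos_of_pos hr (1 / α)).ne'
    have := (Real.rpow_pos_of_pos hx (1 / α)).ne'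
    field_simp

/-- Comparing distribution functions, `Y` transports `f ^ (1 - δ) * h ^ δ / K` to `h`. Multiplying
by `K * (f / h) ^ δ` turns the first density into `f` and the second into its transform. -/
theorem divergenceTransform_spec {δ : ℝ} {h f : LineDensity} (hδ : δ ∈ Ioo (0 : ℝ) 1)
    (hh : h.IsPDF) (hdom : f.dom = h.dom) (hfm : AEMeasurable f.val (volume.restrict f.dom))
    (hf : ∀ᵐ x ∂volume.restrict f.dom, 0 < f.val x)
    (hmass : ∫⁻ x in f.dom, ENNReal.ofReal (f.val x) = 1) :
    ∃ (K : ℝ) (Y : ℝ → ℝ), 0 < K ∧ StrictMonoOn Y h.dom ∧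
      (∀ x ∈ h.dom, (divergenceTransform δ h f).val (Y x) =
        K * (f.val x / h.val x) ^ δ * h.val (Y x)) ∧
      ChangeOfVar Y h.dom f.val h.dom (divergenceTransform δ h f).val := by
  rw [hdom] at hfm hf hmass
  have hD := hh.isOpenInterval
  have hDm := hD.isOpen.measurableSet
  have hhp := hh.ae_pos
  have hmem := ae_restrict_mem (μ := volume) hDm
  have hwm : AEMeasurable (fun x => f.val x ^ (1 - δ) * h.val x ^ δ) (volume.restrict h.dom) :=
    (hfm.pow_const _).mul (hh.aemeasurable.pow_const _)
  have hpos : ∀ᵐ x ∂volume.restrict h.dom, 0 < f.val x ^ (1 - δ) * h.val x ^ δ := by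
    filter_upwards [hf, hhp] with x h1 h2
    positivity
  -- Hölder with weights `1 - δ` and `δ`: the integral is at most `1`.
  have hfin : ∫⁻ x in h.dom, ENNReal.ofReal (f.val x ^ (1 - δ) * h.val x ^ δ) ≠ ⊤ := by
    have h1 := ENNReal.lintegral_mul_norm_pow_le hfm.ennreal_ofReal
      hh.aemeasurable.ennreal_ofReal (sub_nonneg.2 hδ.2.le) hδ.1.le (sub_add_cancel 1 δ)
    rw [hmass, hh.mass] at h1
    have h2 : ∫⁻ x in h.dom, ENNReal.ofReal (f.val x ^ (1 - δ) * h.val x ^ δ) =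
        ∫⁻ x in h.dom, ENNReal.ofReal (f.val x) ^ (1 - δ) * ENNReal.ofReal (h.val x) ^ δ := by
      refine lintegral_congr_ae ?_
      filter_upwards [hf, hhp] with x h3 h4
      rw [ENNReal.ofReal_mul (by positivity), ENNReal.ofReal_rpow_of_pos h3,
        ENNReal.ofReal_rpow_of_pos h4]
    rw [h2]
    refine ne_top_of_le_ne_top ?_ h1
    simp
  have hI := integrableOn_of_lintegral_ne_top hwm (hpos.mono fun _ h => h.le) hfin
  set K := renyiK δ h f with hK
  have hK' : K = ∫ x in h.dom, f.val x ^ (1 - δ) * h.val x ^ δ := by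
    rw [hK, renyiK]; simp only [mul_comm]
  have hK0 : 0 < K := hK' ▸ setIntegral_pos_of_ae_pos hD.isOpen hh.nonempty hI hpos
  set w : ℝ → ℝ := fun x => f.val x ^ (1 - δ) * h.val x ^ δ / K with hw
  have hwpos : ∀ᵐ x ∂volume.restrict h.dom, 0 < w x := hpos.mono fun x hx => div_pos hx hK0
  have hmass' : ∫⁻ x in h.dom, ENNReal.ofReal (w x) = 1 := by
    rw [← ofReal_integral_eq_lintegral_ofReal (hI.div_const _) (hwpos.mono fun _ h => h.le),
      integral_div, ← hK', div_self hK0.ne', ENNReal.ofReal_one]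
  set N : ℝ → ℝ := fun s => ∫ t in h.dom ∩ Iio s, w t with hN
  obtain ⟨hNm, hNcv⟩ := changeOfVar_cdf (W := N) hD (hwm.div_const _) hwpos hmass' fun _ => rfl
  obtain ⟨hCm, hCcv⟩ := hh.cdf_spec
  set Y := divergenceVar δ h f with hY
  have hYdef : ∀ x, Y x = Function.invFunOn (cdf h) h.dom (N x) := fun x => by
    rw [hY, divergenceVar, hN, hdom]
    simp only [hw]
    rw [integral_div]
  have hmaps : MapsTo Y h.dom h.dom := fun x hx => by
    rw [hYdef]; exact Function.invFunOn_mem (hCcv.bijOn.surjOn (hNcv.bijOn.mapsTo hx))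
  have heq : ∀ x ∈ h.dom, cdf h (Y x) = N x := fun x hx => by
    rw [hYdef]; exact Function.invFunOn_eq (hCcv.bijOn.surjOn (hNcv.bijOn.mapsTo hx))
  have hYm : StrictMonoOn Y h.dom := by
    intro a ha b hb hab
    rw [← hCm.lt_iff_lt (hmaps ha) (hmaps hb), heq a ha, heq b hb]
    exact hNm ha hb hab
  have hval : ∀ x ∈ h.dom, (divergenceTransform δ h f).val (Y x) =
      K * (f.val x / h.val x) ^ δ * h.val (Y x) := fun x hx => by
    simp only [divergenceTransform]
    rw [hdom, hYm.injOn.leftInvOn_invFunOn hx]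
  have hcv : ChangeOfVar Y h.dom w h.dom h.val :=
    hCcv.of_comp_eq hNcv hDm hDm hmaps heq
  have hhp' := (hcv.ae_iff _).1 hhp
  refine ⟨K, Y, hK0, hYm, hval, hcv.of_ratio hhp' ?_ ?_⟩
  · filter_upwards [hmem, hf, hhp, hhp'] with x hx h1 h2 h3
    rw [hval x hx]; positivity
  · filter_upwards [hmem, hf, hhp] with x hx h1 h2
    rw [hval x hx, Real.div_rpow h1.le h2.le]
    have := (Real.rpow_pos_of_pos h1 δ).ne'
    have := (Real.rpow_pos_of_pos h2 δ).ne'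
    simp only [hw]
    rw [Real.rpow_sub h1, Real.rpow_one]
    field_simp

end LineDensity

/-! ### Differentiation almost everywhere and the down transformation. -/

section Derivative

variable {D E : Set ℝ} {w W : ℝ → ℝ}

/-- Lebesgue differentiation holds on compact subintervals; rational endpoints keep the exceptional
set a countable union of null sets. -/
theorem ae_hasDerivAt_of_neg_primitive (hD : IsOpenInterval D)
    (hint : ∀ a ∈ D, ∀ b ∈ D, IntervalIntegrable w volume a b)
    (hW : ∀ a ∈ D, ∀ b ∈ D, W a - W b = ∫ x in a..b, w x) :
    ∀ᵐ x ∂volume.restrict D, HasDerivAt W (-w x) x := by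
  rw [ae_restrict_iff' hD.isOpen.measurableSet]
  have h1 : ∀ᵐ x : ℝ, ∀ c d : ℚ, (c : ℝ) ∈ D → (d : ℝ) ∈ D → x ∈ uIcc (c : ℝ) d →
      HasDerivAt (fun y => ∫ t in (c : ℝ)..y, w t) (w x) x := by
    rw [ae_all_iff]; intro c
    rw [ae_all_iff]; intro d
    by_cases hc : (c : ℝ) ∈ D
    · by_cases hd : (d : ℝ) ∈ D
      · filter_upwards [(hint c hc d hd).ae_hasDerivAt_integral] with x hx _ _ hm
        exact hx hm c left_mem_uIcc
      · exact Filter.Eventually.of_forall fun x _ h => absurd h hd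
    · exact Filter.Eventually.of_forall fun x h => absurd h hc
  filter_upwards [h1] with x hx hxD
  obtain ⟨a, ha, hax⟩ := hD.exists_lt hxD
  obtain ⟨b, hb, hxb⟩ := hD.exists_gt hxD
  obtain ⟨c, hac, hcx⟩ := exists_rat_btwn hax
  obtain ⟨d, hxd, hdb⟩ := exists_rat_btwn hxb
  have hcD := hD.ordConnected.out ha hxD ⟨hac.le, hcx.le⟩
  have hdD := hD.ordConnected.out hxD hb ⟨hxd.le, hdb.le⟩
  have h2 := (hx c d hcD hdD (Icc_subset_uIcc ⟨hcx.le, hxd.le⟩)).const_sub (W c)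
  refine h2.congr_of_eventuallyEq ?_
  filter_upwards [hD.isOpen.mem_nhds hxD] with y hy
  rw [← hW c hcD y hy]; ring

/-- A decreasing change of variable from `w` to Lebesgue measure is a primitive of `-w`. -/
theorem ChangeOfVar.neg_primitive (h : ChangeOfVar W D w E fun _ => 1) (hanti : StrictAntiOn W D)
    (hD : IsOpenInterval D) (hE : IsOpenInterval E) (hw : AEMeasurable w (volume.restrict D))
    (hpos : ∀ᵐ x ∂volume.restrict D, 0 < w x) :
    (∀ a ∈ D, ∀ b ∈ D, IntervalIntegrable w volume a b) ∧
      ∀ a ∈ D, ∀ b ∈ D, W a - W b = ∫ x in a..b, w x := by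
  have key : ∀ a ∈ D, ∀ b ∈ D, a ≤ b →
      IntervalIntegrable w volume a b ∧ W a - W b = ∫ x in a..b, w x := by
    intro a ha b hb hab
    have hs := hD.Ioc_subset ha hb
    have h1 := h.setLIntegral_eq hD.isOpen.measurableSet (S := Ioc a b) (T := Ico (W b) (W a))
      measurableSet_Ioc measurableSet_Ico (fun x hx => by
        rw [mem_Ico, mem_Ioc, hanti.le_iff_ge hb hx, hanti.lt_iff_gt hx ha, and_comm])
      fun _ => 1
    have h2 : E ∩ Ico (W b) (W a) = Ico (W b) (W a) := inter_eq_right.2 fun t ht =>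
      hE.ordConnected.out (h.bijOn.mapsTo hb) (h.bijOn.mapsTo ha) ⟨ht.1, ht.2.le⟩
    have hnn : ∀ᵐ x ∂volume.restrict (Ioc a b), 0 ≤ w x :=
      (ae_pos_Ioc hD hpos ha hb).mono fun _ h => h.le
    rw [h2, inter_eq_right.2 hs] at h1
    simp only [ENNReal.ofReal_one, mul_one, one_mul, lintegral_const, Measure.restrict_apply,
      MeasurableSet.univ, univ_inter, Real.volume_Ico] at h1
    have hi : IntegrableOn w (Ioc a b) := integrableOn_of_lintegral_ne_top
      (hw.mono_measure (Measure.restrict_mono hs le_rfl)) hnn (h1 ▸ ENNReal.ofReal_ne_top)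
    refine ⟨(intervalIntegrable_iff_integrableOn_Ioc_of_le hab).2 hi, ?_⟩
    rw [← ofReal_integral_eq_lintegral_ofReal hi hnn, ENNReal.ofReal_eq_ofReal_iff
      (sub_nonneg.2 ((hanti.le_iff_ge hb ha).2 hab)) (integral_nonneg_of_ae hnn)] at h1
    rw [h1, intervalIntegral.integral_of_le hab]
  refine ⟨fun a ha b hb => ?_, fun a ha b hb => ?_⟩
  · rcases le_total a b with hab | hab
    · exact (key a ha b hb hab).1
    · exact (key b hb a ha hab).1.symm
  · rcases le_total a b with hab | hab
    · exact (key a ha b hb hab).2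
    · rw [intervalIntegral.integral_symm, ← (key b hb a ha hab).2]; ring

/-- Differentiability of `W` at a single point suffices: the inverse is continuous because it is
monotone with an image that is a neighbourhood. -/
theorem StrictAntiOn.hasDerivAt_invFunOn (hD : IsOpenInterval D) (hE : IsOpenInterval E)
    (hanti : StrictAntiOn W D) (hbij : BijOn W D E) {x d : ℝ} (hx : x ∈ D)
    (hd : HasDerivAt W d x) (hd0 : d ≠ 0) : HasDerivAt (Function.invFunOn W D) d⁻¹ (W x) := by
  set S := Function.invFunOn W D with hS
  have hl : ∀ y ∈ D, S (W y) = y := fun y hy => hanti.injOn.leftInvOn_invFunOn hy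
  have hr : ∀ t ∈ E, W (S t) = t := fun t ht => Function.invFunOn_eq (hbij.surjOn ht)
  have hSm : ∀ t ∈ E, S t ∈ D := fun t ht => Function.invFunOn_mem (hbij.surjOn ht)
  have hWx := hE.isOpen.mem_nhds (hbij.mapsTo hx)
  have hcont : ContinuousAt (fun t => -S t) (W x) := by
    refine StrictMonoOn.continuousAt_of_image_mem_nhds (s := E) ?_ hWx ?_
    · intro s hs t ht hst
      rw [neg_lt_neg_iff, ← hanti.lt_iff_gt (hSm s hs) (hSm t ht), hr s hs, hr t ht]
      exact hst
    · rw [hl x hx]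
      refine Filter.mem_of_superset (hD.neg.isOpen.mem_nhds
        (show -x ∈ Neg.neg ⁻¹' D by simpa using hx)) ?_
      intro y hy
      exact ⟨W (-y), hbij.mapsTo hy, by simp only [hl (-y) hy, neg_neg]⟩
  have hcont' : ContinuousAt S (W x) := 
    hcont.neg.congr (Filter.Eventually.of_forall fun t => neg_neg (S t))
  refine HasDerivAt.of_local_left_inverse hcont' (by rwa [hl x hx]) hd0 ?_
  filter_upwards [hWx] with t ht using hr t ht

end Derivative

theorem changeOfVar_const_mul_rpow {D : Set ℝ} (hD : IsOpenInterval D) (h0 : D ⊆ Ioi 0) {c δ : ℝ}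
    (hc : 0 < c) (hδ : 0 < δ) :
    StrictMonoOn (fun t => c * t ^ δ) D ∧ IsOpenInterval ((fun t => c * t ^ δ) '' D) ∧
      ChangeOfVar (fun t => c * t ^ δ) D (fun t => c * (δ * t ^ (δ - 1)))
        ((fun t => c * t ^ δ) '' D) fun _ => 1 := by
  have hcont : ContinuousOn (fun t : ℝ => c * (δ * t ^ (δ - 1))) D :=
    ((continuousOn_id.rpow_const fun t ht => Or.inl (h0 ht).ne').const_smul δ).const_smul c
  have hpos : ∀ᵐ t ∂volume.restrict D, 0 < c * (δ * t ^ (δ - 1)) := by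
    filter_upwards [ae_restrict_mem hD.isOpen.measurableSet] with t ht
    have : 0 < t := h0 ht
    positivity
  have hint : ∀ a ∈ D, ∀ b ∈ D,
      IntervalIntegrable (fun t : ℝ => c * (δ * t ^ (δ - 1))) volume a b := fun a ha b hb =>
    (hcont.mono (hD.uIcc_subset ha hb)).intervalIntegrable
  have hW : ∀ a ∈ D, ∀ b ∈ D, (fun t => c * t ^ δ) b - (fun t => c * t ^ δ) a =
      ∫ t in a..b, c * (δ * t ^ (δ - 1)) := by
    intro a ha b hb
    rw [intervalIntegral.integral_eq_sub_of_hasDerivAt (fun t ht => ?_) (hint a ha b hb)]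
    exact (Real.hasDerivAt_rpow_const (Or.inl (h0 (hD.uIcc_subset ha hb ht)).ne')).const_mul c
  have hm := strictMonoOn_of_primitive hD hpos hint hW
  exact ⟨hm, image_isOpenInterval hD hm (continuousOn_of_primitive hD hint hW),
    changeOfVar_of_primitive hD (hcont.aemeasurable hD.isOpen.measurableSet) hpos hint hW⟩

/-- The down transformation of a density given parametrically by a power function. -/
theorem LineDensity.down_spec {γ δ c : ℝ} (hγ : γ ≠ 2) (hδ : 0 < δ) (hc : 0 < c) {D : Set ℝ}
    {F T : ℝ → ℝ} {G : LineDensity} (hD : IsOpenInterval D) (h0 : D ⊆ Ioi 0)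
    (hFm : AEMeasurable F (volume.restrict D)) (hF : ∀ᵐ t ∂volume.restrict D, 0 < F t)
    (hG : IsOpenInterval G.dom) (hT : StrictAntiOn T D) (hcv : ChangeOfVar T D F G.dom G.val)
    (hval : ∀ t ∈ D, G.val (T t) = c * t ^ (-(δ / (γ - 2)))) :
    ∃ c' : ℝ, 0 < c' ∧ IsOpenInterval (down γ G).dom ∧
      AEMeasurable (down γ G).val (volume.restrict (down γ G).dom) ∧
      ChangeOfVar (fun t => c' * t ^ δ) D F (down γ G).dom (down γ G).val ∧
      ∀ᵐ s ∂volume.restrict (down γ G).dom, 0 < (down γ G).val s := by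
  have hγ' : γ - 2 ≠ 0 := sub_ne_zero.2 hγ
  have hγa : 0 < |γ - 2| := abs_pos.2 hγ'
  have hmem := ae_restrict_mem (μ := volume) hD.isOpen.measurableSet
  set e := δ / (γ - 2) with he
  set c' := c ^ (2 - γ) / |γ - 2| with hc'
  have hc0 : 0 < c' := by positivity
  obtain ⟨hSm, hSI, hScv⟩ := changeOfVar_const_mul_rpow hD h0 hc0 hδ
  have hds : ∀ t ∈ D, downVar γ G (T t) = c' * t ^ δ := by
    intro t ht
    have ht0 : 0 < t := h0 ht
    rw [downVar, hval t ht, Real.mul_rpow hc.le (by positivity), ← Real.rpow_mul ht0.le,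
      show -e * (2 - γ) = δ by rw [he]; field_simp; ring, hc']
    ring
  have hdom : (down γ G).dom = (fun t => c' * t ^ δ) '' D := by
    change downVar γ G '' G.dom = _
    rw [← hcv.bijOn.image_eq, image_image]
    exact image_congr hds
  have hinj : InjOn (downVar γ G) G.dom := by
    intro s hs t ht hst
    obtain ⟨a, ha, rfl⟩ := hcv.bijOn.surjOn hs
    obtain ⟨b, hb, rfl⟩ := hcv.bijOn.surjOn ht
    rw [hds a ha, hds b hb] at hst
    rw [hSm.injOn ha hb hst]
  have hdv : ∀ t ∈ D, (down γ G).val (c' * t ^ δ) =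
      (c * t ^ (-e)) ^ γ * |deriv G.val (T t)|⁻¹ := by
    intro t ht
    simp only [down]
    rw [← hds t ht, hinj.leftInvOn_invFunOn (hcv.bijOn.mapsTo ht), hval t ht]
  -- This is `|T'|`: mass preservation gives `G(T t) * |T' t| = F t`, and `G(T t)` is the known
  -- power of `t`.
  set w : ℝ → ℝ := fun t => F t / (c * t ^ (-e)) with hw
  have hGpos : ∀ᵐ t ∂volume.restrict D, 0 < G.val (T t) := by
    filter_upwards [hmem] with t ht
    have : 0 < t := h0 ht
    rw [hval t ht]; positivity
  have hcv1 : ChangeOfVar T D w G.dom fun _ => 1 := by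
    refine hcv.of_ratio hGpos (by simp) ?_
    filter_upwards [hmem, hGpos] with t ht hp
    rw [hval t ht] at hp ⊢
    rw [hw, one_mul, div_mul_cancel₀ _ hp.ne']
  have hwm : AEMeasurable w (volume.restrict D) :=
    hFm.div (by fun_prop)
  have hwpos : ∀ᵐ t ∂volume.restrict D, 0 < w t := by
    filter_upwards [hmem, hF] with t ht hp
    have : 0 < t := h0 ht
    positivity
  obtain ⟨hint, hprim⟩ := hcv1.neg_primitive hT hD hG hwm hwpos
  have hder := ae_hasDerivAt_of_neg_primitive hD hint hprim
  -- The derivative of `G` comes from the chain rule through `T⁻¹`. In `G ^ γ / |G'|` times `(c' * t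
  -- ^ δ)'` all powers of `t` cancel and `F` remains, so the down variable preserves mass.
  have hHval : ∀ᵐ t ∂volume.restrict D,
      (down γ G).val (c' * t ^ δ) * (c' * (δ * t ^ (δ - 1))) = F t := by
    filter_upwards [hmem, hF, hwpos, hder] with t ht hFt hwt hd
    have ht0 : 0 < t := h0 ht
    have h1 := StrictAntiOn.hasDerivAt_invFunOn hD hG hT hcv.bijOn ht hd (neg_ne_zero.2 hwt.ne')
    have hl : Function.invFunOn T D (T t) = t := hT.injOn.leftInvOn_invFunOn ht
    have h2 := (h1.rpow_const (p := -e) (Or.inl (by rw [hl]; exact ht0.ne'))).const_mul c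
    have h3 : HasDerivAt G.val _ (T t) := h2.congr_of_eventuallyEq <| by
      filter_upwards [hG.isOpen.mem_nhds (hcv.bijOn.mapsTo ht)] with v hv
      obtain ⟨a, ha, rfl⟩ := hcv.bijOn.surjOn hv
      rw [hval a ha, hT.injOn.leftInvOn_invFunOn ha]
    set X := t ^ (-e) with hX
    have hX0 : 0 < X := Real.rpow_pos_of_pos ht0 _
    have hcX : 0 < c * X := mul_pos hc hX0
    set Q := (c * X) ^ (2 - γ) with hQ
    have hQ0 : 0 < Q := Real.rpow_pos_of_pos hcX _
    have h4 : c' * t ^ δ = Q / |γ - 2| := by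
      rw [← hds t ht, downVar, hval t ht]
    have h5 : (c * X) ^ γ = (c * X) ^ 2 / Q := by
      rw [hQ, ← Real.rpow_natCast (c * X) 2, ← Real.rpow_sub hcX]
      congr 1; push_cast; ring
    have h6 : |deriv G.val (T t)| = c * ((w t)⁻¹ * (δ / |γ - 2|) * (X / t)) := by
      rw [h3.deriv, hl, Real.rpow_sub ht0, Real.rpow_one, ← hX, abs_mul, abs_mul, abs_mul,
        abs_of_pos hc, abs_inv, abs_neg, abs_neg, abs_of_pos hwt, he, abs_div, abs_of_pos hδ,
        abs_of_pos (div_pos hX0 ht0)]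
    have h7 : c' * (δ * t ^ (δ - 1)) = Q / |γ - 2| * (δ / t) := by
      rw [← h4, Real.rpow_sub ht0, Real.rpow_one]; ring
    rw [hdv t ht, h5, h6, h7]
    simp only [hw, ← hX]
    field_simp
  have hHnn : ∀ᵐ t ∂volume.restrict D, 0 < (down γ G).val (c' * t ^ δ) := by
    filter_upwards [hmem, hF, hHval] with t ht hFt hv
    have ht0 : 0 < t := h0 ht
    rw [← hv] at hFt
    exact pos_of_mul_pos_left hFt (by positivity)
  have hH : ChangeOfVar (fun t => c' * t ^ δ) D F (down γ G).dom (down γ G).val := by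
    rw [hdom]
    refine hScv.of_ratio (by simp) (hHnn.mono fun _ h => h.le) ?_
    filter_upwards [hHval] with t ht
    rw [ht, mul_one]
  have hHm : AEMeasurable (down γ G).val (volume.restrict (down γ G).dom) := by
    rw [hH.aemeasurable_iff]
    refine (hFm.div (g := fun t => c' * (δ * t ^ (δ - 1))) (by fun_prop)).congr ?_
    filter_upwards [hmem, hHval] with t ht hv
    have ht0 : 0 < t := h0 ht
    have : 0 < c' * (δ * t ^ (δ - 1)) := by have := hδ; positivity
    rw [Pi.div_apply, ← hv, mul_div_cancel_right₀ _ this.ne']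
  exact ⟨c', hc0, hdom ▸ hSI, hHm, hH, (hH.ae_iff _).2 hHnn⟩

/-! ### Log-convexity of the moments and comparison of secant slopes. -/

section Moments

variable {D : Set ℝ} {c : ℝ → ℝ≥0∞} {f : ℝ → ℝ}

/-- Hölder's inequality for moments of order `a` and `b`. -/
theorem lintegral_rpow_mul_le (hc : AEMeasurable c (volume.restrict D))
    (hf : AEMeasurable f (volume.restrict D))
    (hc0 : ∀ᵐ x ∂volume.restrict D, c x ≠ 0 ∧ c x ≠ ⊤) {a b s t : ℝ}
    (hs : 0 ≤ s) (ht : 0 ≤ t) (hst : s + t = 1) :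
    ∫⁻ x in D, c x ^ (s * a + t * b) * ENNReal.ofReal (f x) ≤
      (∫⁻ x in D, c x ^ a * ENNReal.ofReal (f x)) ^ s *
        (∫⁻ x in D, c x ^ b * ENNReal.ofReal (f x)) ^ t := by
  refine le_trans (le_of_eq ?_) (ENNReal.lintegral_mul_norm_pow_le
    ((hc.pow_const a).mul hf.ennreal_ofReal) ((hc.pow_const b).mul hf.ennreal_ofReal) hs ht hst)
  refine lintegral_congr_ae ?_
  filter_upwards [hc0] with x hx
  simp only [Pi.mul_apply]
  rw [ENNReal.mul_rpow_of_nonneg _ _ hs, ENNReal.mul_rpow_of_nonneg _ _ ht, ← ENNReal.rpow_mul,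
    ← ENNReal.rpow_mul, mul_mul_mul_comm, ← ENNReal.rpow_add _ _ hx.1 hx.2,
    ← ENNReal.rpow_add_of_nonneg _ _ hs ht, hst, ENNReal.rpow_one, mul_comm a, mul_comm b]

theorem lintegral_rpow_mul_ne_zero (hD : IsOpen D) (hne : D.Nonempty)
    (hc : AEMeasurable c (volume.restrict D)) (hf : AEMeasurable f (volume.restrict D))
    (hc0 : ∀ᵐ x ∂volume.restrict D, c x ≠ 0 ∧ c x ≠ ⊤)
    (hf0 : ∀ᵐ x ∂volume.restrict D, 0 < f x) (a : ℝ) :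
    ∫⁻ x in D, c x ^ a * ENNReal.ofReal (f x) ≠ 0 := by
  intro h
  replace h := (lintegral_eq_zero_iff' ((hc.pow_const a).mul hf.ennreal_ofReal)).1 h
  have hfalse : ∀ᵐ _ ∂volume.restrict D, False := by
    filter_upwards [h, hc0, hf0] with x hx hcx hfx
    rcases mul_eq_zero.1 (show c x ^ a * ENNReal.ofReal (f x) = 0 from hx) with h' | h'
    · exact (ENNReal.rpow_pos (pos_iff_ne_zero.2 hcx.1) hcx.2).ne' h'
    · exact (ENNReal.ofReal_pos.2 hfx).ne' h'
  rw [Filter.eventually_false_iff_eq_bot, ae_eq_bot, Measure.restrict_eq_zero] at hfalse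
  exact (hD.measure_pos volume hne).ne' hfalse

end Moments

section LogConvex

variable {m : ℝ → ℝ≥0∞}

theorem ne_top_of_logConvex (hm : ∀ a b s t : ℝ, 0 ≤ s → 0 ≤ t → s + t = 1 →
    m (s * a + t * b) ≤ m a ^ s * m b ^ t) {a b s t : ℝ} (ha : m a ≠ ⊤) (hb : m b ≠ ⊤)
    (hs : 0 ≤ s) (ht : 0 ≤ t) (hst : s + t = 1) : m (s * a + t * b) ≠ ⊤ :=
  ne_top_of_le_ne_top (ENNReal.mul_ne_top (ENNReal.rpow_ne_top_of_nonneg hs ha)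
    (ENNReal.rpow_ne_top_of_nonneg ht hb)) (hm a b s t hs ht hst)

theorem convexOn_log_of_logConvex (h0 : ∀ a, m a ≠ 0)
    (hm : ∀ a b s t : ℝ, 0 ≤ s → 0 ≤ t → s + t = 1 → m (s * a + t * b) ≤ m a ^ s * m b ^ t) :
    ConvexOn ℝ {a | m a ≠ ⊤} fun a => Real.log (m a).toReal := by
  refine ⟨fun a ha b hb s t hs ht hst => ne_top_of_logConvex hm ha hb hs ht hst,
    fun a ha b hb s t hs ht hst => ?_⟩
  have hpos : ∀ x, m x ≠ ⊤ → 0 < (m x).toReal := fun x hx => ENNReal.toReal_pos (h0 x) hx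
  have h1 := ENNReal.toReal_mono (ENNReal.mul_ne_top (ENNReal.rpow_ne_top_of_nonneg hs ha)
    (ENNReal.rpow_ne_top_of_nonneg ht hb)) (hm a b s t hs ht hst)
  rw [ENNReal.toReal_mul, ← ENNReal.toReal_rpow, ← ENNReal.toReal_rpow] at h1
  have h2 := Real.log_le_log (hpos _ (ne_top_of_logConvex hm ha hb hs ht hst)) h1
  have ha' := hpos a ha
  have hb' := hpos b hb
  rwa [Real.log_mul (by positivity) (by positivity), Real.log_rpow ha', Real.log_rpow hb'] at h2

/-- Comparison of the secant slopes on `[δ q, q]` and `[δ p, p]`. -/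
theorem ConvexOn.div_sub_div_le_of_scaling {s : Set ℝ} {φ : ℝ → ℝ} (hφ : ConvexOn ℝ s φ)
    {p q δ : ℝ} (hp0 : p ≠ 0) (hq0 : q ≠ 0) (hqp : q < p) (hδ : δ ∈ Ioo (0 : ℝ) 1)
    (hp : p ∈ s) (hq : q ∈ s) (hδp : δ * p ∈ s) (hδq : δ * q ∈ s) :
    φ (δ * p) / p - φ (δ * q) / q ≤ φ p / p - φ q / q := by
  have h1δ : 0 < 1 - δ := sub_pos.2 hδ.2
  have hδ0 := hδ.1
  have hpp : p ≠ δ * p := fun h => mul_ne_zero h1δ.ne' hp0 (by linarith)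
  have hqq : q ≠ δ * q := fun h => mul_ne_zero h1δ.ne' hq0 (by linarith)
  have hδqp : δ * q < δ * p := mul_lt_mul_of_pos_left hqp hδ0
  have hflip : ∀ a b, (φ a - φ b) / (a - b) = (φ b - φ a) / (b - a) := fun a b => by
    rw [← neg_sub (φ b), ← neg_sub b, neg_div_neg_eq]
  have key : (φ q - φ (δ * q)) / (q - δ * q) ≤ (φ p - φ (δ * p)) / (p - δ * p) := by
    -- The two slopes are compared through the secant between `δ q` and `p`. It degenerates when `p
    -- = δ q`, and then the secant between `q` and `δ p` is used.
    by_cases h : p = δ * q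
    · have hne : q ≠ δ * p := by
        intro h'
        have : (1 - δ * δ) * p = 0 := by rw [h'] at h; linarith
        rcases mul_eq_zero.1 this with h'' | h''
        · nlinarith [hδ.2]
        · exact hp0 h''
      calc (φ q - φ (δ * q)) / (q - δ * q) = (φ (δ * q) - φ q) / (δ * q - q) := hflip _ _
        _ ≤ (φ (δ * p) - φ q) / (δ * p - q) := hφ.secant_mono hq hδq hδp hqq.symm hne.symm hδqp.le
        _ = (φ q - φ (δ * p)) / (q - δ * p) := hflip _ _
        _ ≤ (φ p - φ (δ * p)) / (p - δ * p) := hφ.secant_mono hδp hq hp hne hpp hqp.le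
    · calc (φ q - φ (δ * q)) / (q - δ * q) ≤ (φ p - φ (δ * q)) / (p - δ * q) :=
            hφ.secant_mono hδq hq hp hqq h hqp.le
        _ = (φ (δ * q) - φ p) / (δ * q - p) := hflip _ _
        _ ≤ (φ (δ * p) - φ p) / (δ * p - p) :=
            hφ.secant_mono hp hδq hδp (Ne.symm h) hpp.symm hδqp.le
        _ = (φ p - φ (δ * p)) / (p - δ * p) := hflip _ _
  have e : ∀ x, (φ x - φ (δ * x)) / (x - δ * x) = (φ x / x - φ (δ * x) / x) / (1 - δ) := by
    intro x
    rw [show x - δ * x = x * (1 - δ) by ring, ← div_div, sub_div]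
  rw [e, e, div_le_div_iff_of_pos_right h1δ] at key
  linarith

end LogConvex

/-! ### Quotients of extended nonnegative reals. -/

section ENNRealExp

theorem ofReal_exp_mul (x y : ℝ) : ENNReal.ofReal (Real.exp x) * ENNReal.ofReal (Real.exp y) =
    ENNReal.ofReal (Real.exp (x + y)) := by
  rw [← ENNReal.ofReal_mul (Real.exp_pos x).le, Real.exp_add]

theorem ofReal_exp_rpow (x t : ℝ) :
    ENNReal.ofReal (Real.exp x) ^ t = ENNReal.ofReal (Real.exp (x * t)) := by
  rw [ENNReal.ofReal_rpow_of_pos (Real.exp_pos x), Real.exp_mul]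

theorem ofReal_exp_div (x y : ℝ) : ENNReal.ofReal (Real.exp x) / ENNReal.ofReal (Real.exp y) =
    ENNReal.ofReal (Real.exp (x - y)) := by
  rw [← ENNReal.ofReal_div_of_pos (Real.exp_pos y), Real.exp_sub]

theorem eq_ofReal_exp_log {x : ℝ≥0∞} (h0 : x ≠ 0) (ht : x ≠ ⊤) :
    x = ENNReal.ofReal (Real.exp (Real.log x.toReal)) := by
  rw [Real.exp_log (ENNReal.toReal_pos h0 ht), ENNReal.ofReal_toReal ht]

/-- An infinite `x` has total exponent `a * c > 0` and an infinite `z` has total exponent `-(b * c)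
> 0`. Both push to `⊤`, so no indeterminate form arises. -/
theorem ENNReal.div_rpow_eq_top {x z : ℝ≥0∞} {a b c : ℝ} (hx : x ≠ 0) (hz : z ≠ 0) (hc : c ≠ 0)
    (hxa : x = ⊤ → 0 < a * c) (hzb : z = ⊤ → b * c < 0) (h : x = ⊤ ∨ z = ⊤) :
    (x ^ a / z ^ b) ^ c = ⊤ := by
  rcases lt_or_gt_of_ne hc with hc | hc
  · have hxa' : x = ⊤ → a < 0 := fun h => neg_of_mul_pos_left (hxa h) hc.le
    have hzb' : z = ⊤ → 0 < b := fun h => by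
      by_contra hb
      exact absurd (hzb h) (not_lt.2 (mul_nonneg_of_nonpos_of_nonpos (not_lt.1 hb) hc.le))
    have : x ^ a / z ^ b = 0 := by
      rw [ENNReal.div_eq_zero_iff]
      by_cases hxt : x = ⊤
      · left; rw [hxt, ENNReal.top_rpow_of_neg (hxa' hxt)]
      · right
        have hzt := h.resolve_left hxt
        rw [hzt, ENNReal.top_rpow_of_pos (hzb' hzt)]
    rw [this, ENNReal.zero_rpow_of_neg hc]
  · have hxa' : x = ⊤ → 0 < a := fun h => pos_of_mul_pos_left (hxa h) hc.le
    have hzb' : z = ⊤ → b < 0 := fun h => by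
      by_contra hb
      exact absurd (hzb h) (not_lt.2 (mul_nonneg (not_lt.1 hb) hc.le))
    have : x ^ a / z ^ b = ⊤ := by
      rw [ENNReal.div_eq_top]
      by_cases hzt : z = ⊤
      · left
        refine ⟨?_, by rw [hzt, ENNReal.top_rpow_of_neg (hzb' hzt)]⟩
        by_cases hxt : x = ⊤
        · rw [hxt, ENNReal.top_rpow_of_pos (hxa' hxt)]; simp
        · exact (ENNReal.rpow_pos (pos_iff_ne_zero.2 hx) hxt).ne'
      · right
        have hxt := h.resolve_right hzt
        refine ⟨by rw [hxt, ENNReal.top_rpow_of_pos (hxa' hxt)], ?_⟩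
        exact ENNReal.rpow_ne_top_of_ne_zero hz hzt
    rw [this, ENNReal.top_rpow_of_pos hc]

end ENNRealExp

/-! ### The complexity inequality for an abstract log-convex family. -/

/-- The monotonicity of the complexity, for a log-convex family of moments. -/
theorem div_rpow_le_of_logConvex {m : ℝ → ℝ≥0∞} (h0 : ∀ a, m a ≠ 0) (hzero : m 0 ≠ ⊤)
    (hm : ∀ a b s t : ℝ, 0 ≤ s → 0 ≤ t → s + t = 1 → m (s * a + t * b) ≤ m a ^ s * m b ^ t)
    {p q γ α δ C : ℝ} (hC : 0 < C) (hp : p ≠ 0) (hq : q ≠ 0) (hγ : γ ≠ 2) (hα : α ≠ 0)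
    (hsign : SignType.sign (p - q) = SignType.sign α * SignType.sign (γ - 2))
    (hδ : δ ∈ Ioo (0 : ℝ) 1) (hdet : 0 < p * q → m p ≠ ⊤ ∨ m q ≠ ⊤) :
    ((ENNReal.ofReal C ^ p * m (δ * p)) ^ (1 / ((γ - 2) * p)) /
      (ENNReal.ofReal C ^ q * m (δ * q)) ^ (1 / ((γ - 2) * q))) ^ (1 / α) ≤
    (m p ^ (1 / ((γ - 2) * p)) / m q ^ (1 / ((γ - 2) * q))) ^ (1 / α) := by
  have hγ' : γ - 2 ≠ 0 := sub_ne_zero.2 hγ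
  rw [← sign_mul] at hsign
  have hσ : α * (γ - 2) ≠ 0 := mul_ne_zero hα hγ'
  have hcase : (0 < α * (γ - 2) ∧ q < p) ∨ (α * (γ - 2) < 0 ∧ p < q) := by
    rcases lt_or_gt_of_ne hσ with h | h
    · rw [sign_neg h, sign_eq_neg_one_iff] at hsign
      exact Or.inr ⟨h, by linarith⟩
    · rw [sign_pos h, sign_eq_one_iff] at hsign
      exact Or.inl ⟨h, by linarith⟩
  -- The condition `a * a ≤ a * b` says that `a` lies between `0` and `b`, and `m 0` is finite.
  have hbetween : ∀ a b, m b ≠ ⊤ → a ≠ 0 → a * a ≤ a * b → m a ≠ ⊤ := by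
    intro a b hb ha hab
    have haa : 0 < a * a := mul_self_pos.2 ha
    have hb0 : b ≠ 0 := by rintro rfl; linarith
    have hab0 : 0 < a * b := by linarith
    have hbb : 0 < b * b := mul_self_pos.2 hb0
    have hratio : 0 ≤ a / b ∧ a / b ≤ 1 := by
      rw [show a / b = (a * b) / (b * b) by field_simp]
      refine ⟨by positivity, (div_le_one hbb).2 ?_⟩
      nlinarith [sq_nonneg (a - b)]
    have := ne_top_of_logConvex hm hb hzero hratio.1 (sub_nonneg.2 hratio.2)
      (add_sub_cancel (a / b) 1)
    rwa [div_mul_cancel₀ _ hb0, mul_zero, add_zero] at this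
  by_cases hfin : m p ≠ ⊤ ∧ m q ≠ ⊤
  · have hconv := convexOn_log_of_logConvex h0 hm
    have hscale : ∀ a, m a ≠ ⊤ → m (δ * a) ≠ ⊤ := fun a ha => by
      have := ne_top_of_logConvex hm ha hzero hδ.1.le (sub_nonneg.2 hδ.2.le) (add_sub_cancel δ 1)
      rwa [mul_zero, add_zero] at this
    have hδp := hscale p hfin.1
    have hδq := hscale q hfin.2
    set φ : ℝ → ℝ := fun a => Real.log (m a).toReal with hφ
    have hexp : ∀ a, m a ≠ ⊤ → m a = ENNReal.ofReal (Real.exp (φ a)) := fun a ha =>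
      eq_ofReal_exp_log (h0 a) ha
    rw [hexp _ hδp, hexp _ hδq, hexp _ hfin.1, hexp _ hfin.2, ← Real.exp_log hC]
    simp only [ofReal_exp_rpow, ofReal_exp_mul, ofReal_exp_div]
    refine ENNReal.ofReal_le_ofReal (Real.exp_le_exp.2 ?_)
    -- Both quotients contain the same term `log C / (γ - 2)`, which drops out.
    have e1 : ((Real.log C * p + φ (δ * p)) * (1 / ((γ - 2) * p)) -
        (Real.log C * q + φ (δ * q)) * (1 / ((γ - 2) * q))) * (1 / α) =
        (φ (δ * p) / p - φ (δ * q) / q) / (α * (γ - 2)) := by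
      field_simp
      ring
    have e2 : (φ p * (1 / ((γ - 2) * p)) - φ q * (1 / ((γ - 2) * q))) * (1 / α) =
        (φ p / p - φ q / q) / (α * (γ - 2)) := by
      field_simp
    rw [e1, e2]
    rcases hcase with ⟨hs, hlt⟩ | ⟨hs, hlt⟩
    · rw [div_le_div_iff_of_pos_right hs]
      exact hconv.div_sub_div_le_of_scaling hp hq hlt hδ hfin.1 hfin.2 hδp hδq
    · rw [div_le_div_right_of_neg hs]
      have := hconv.div_sub_div_le_of_scaling hq hp hlt hδ hfin.2 hfin.1 hδq hδp
      linarith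
  · have hdet' : m p = ⊤ → m q = ⊤ → p * q < 0 := fun h1 h2 => by
      by_contra hpq
      rcases hdet (lt_of_le_of_ne (not_lt.1 hpq) (mul_ne_zero hp hq).symm) with h | h
      · exact h h1
      · exact h h2
    -- Otherwise `p` lies between `0` and `q`, so the moment of order `q` is infinite as well. Then
    -- `p` and `q` must have opposite signs, which is impossible. The argument for `q` is symmetric.
    have hppos : m p = ⊤ → 0 < p * (α * (γ - 2)) := by
      intro hpt
      by_contra hneg
      have hneg' := not_lt.1 hneg
      have hqt : m q = ⊤ := by
        by_contra hq'
        refine hbetween p q hq' hp ?_ hpt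
        rcases hcase with ⟨hs, hlt⟩ | ⟨hs, hlt⟩
        · have : p ≤ 0 := nonpos_of_mul_nonpos_left hneg' hs
          nlinarith
        · have : 0 ≤ p := by by_contra h; nlinarith
          nlinarith
      have := hdet' hpt hqt
      rcases hcase with ⟨hs, hlt⟩ | ⟨hs, hlt⟩
      · have : p ≤ 0 := nonpos_of_mul_nonpos_left hneg' hs
        nlinarith
      · have : 0 ≤ p := by by_contra h; nlinarith
        nlinarith
    have hqneg : m q = ⊤ → q * (α * (γ - 2)) < 0 := by
      intro hqt
      by_contra hneg
      have hneg' := not_lt.1 hneg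
      have hpt : m p = ⊤ := by
        by_contra hp'
        refine hbetween q p hp' hq ?_ hqt
        rcases hcase with ⟨hs, hlt⟩ | ⟨hs, hlt⟩
        · have : 0 ≤ q := by by_contra h; nlinarith
          nlinarith
        · have : q ≤ 0 := by by_contra h; nlinarith
          nlinarith
      have := hdet' hpt hqt
      rcases hcase with ⟨hs, hlt⟩ | ⟨hs, hlt⟩
      · have : 0 ≤ q := by by_contra h; nlinarith
        nlinarith
      · have : q ≤ 0 := by by_contra h; nlinarith
        nlinarith
    have hinv : ∀ x : ℝ, 1 / ((γ - 2) * x) * (1 / α) = (x * (α * (γ - 2)))⁻¹ := fun x => by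
      rw [← one_div_mul_one_div_rev, ← one_div, ← one_div_mul_one_div_rev,
        ← one_div_mul_one_div_rev]
      ring
    refine le_of_le_of_eq le_top (ENNReal.div_rpow_eq_top (h0 p) (h0 q) (one_div_ne_zero hα)
      (fun h => ?_) (fun h => ?_) ?_).symm
    · rw [hinv]; exact inv_pos.2 (hppos h)
    · rw [hinv]; exact inv_lt_zero.2 (hqneg h)
    · by_contra h
      push Not at h
      exact hfin h

/-! ### The full chain of transformations in the escort variable. -/

namespace LineDensity

/-- The divergence transformation of the image under `relUp`, in terms of the variable of the
escort density of `f`. -/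
theorem divergenceTransform_relUp_spec {γ α δ : ℝ} {f h : LineDensity} (hγ : γ ≠ 2) (hα : α ≠ 0)
    (hδ : δ ∈ Ioo (0 : ℝ) 1) (hh : h.IsPDF) {F : LineDensity} (hF : F = relEscort α h f)
    (hD : IsOpenInterval F.dom) (hne : F.dom.Nonempty) (h0 : F.dom ⊆ Ioi 0)
    (hFm : AEMeasurable F.val (volume.restrict F.dom))
    (hFpos : ∀ᵐ t ∂volume.restrict F.dom, 0 < F.val t)
    (hmass : ∫⁻ t in F.dom, ENNReal.ofReal (F.val t) = 1)
    (hup : InverseAdmissible α (up γ F)) :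
    ∃ (c : ℝ) (Z : ℝ → ℝ), 0 < c ∧ StrictAntiOn Z F.dom ∧
      ChangeOfVar Z F.dom F.val h.dom (divergenceTransform δ h (relUp γ α h f)).val ∧
      ∀ t ∈ F.dom, 0 < (divergenceTransform δ h (relUp γ α h f)).val (Z t) ∧
        ((divergenceTransform δ h (relUp γ α h f)).val (Z t) / h.val (Z t)) ^ α =
          c * t ^ (-(δ / (γ - 2))) := by
  have hγ' : γ - 2 ≠ 0 := sub_ne_zero.2 hγ
  have hγa : 0 < |γ - 2| := abs_pos.2 hγ'
  have hDm := hD.isOpen.measurableSet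
  have hΩ := hh.isOpen.measurableSet
  have hFi : IntegrableOn F.val F.dom := integrableOn_of_lintegral_ne_top hFm
    (hFpos.mono fun _ h => h.le) (by simp [hmass])
  obtain ⟨hum, hgI, hgval, hucv⟩ := up_spec hγ hD h0 hFm hFpos hFi
  set g := up γ F with hg
  set u := upVar γ F with hu
  have hgpos' : ∀ t ∈ F.dom, 0 < g.val (u t) := fun t ht => by
    rw [hgval t ht]
    have : 0 < |(γ - 2) * t| := abs_pos.2 (mul_ne_zero hγ' (h0 ht).ne')
    positivity
  have hgpos : ∀ s ∈ g.dom, 0 < g.val s := fun s hs => by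
    obtain ⟨t, ht, rfl⟩ := hucv.bijOn.surjOn hs
    exact hgpos' t ht
  have hgpos_ae : ∀ᵐ s ∂volume.restrict g.dom, 0 < g.val s := by
    filter_upwards [ae_restrict_mem hgI.isOpen.measurableSet] with s hs using hgpos s hs
  have hgm : AEMeasurable g.val (volume.restrict g.dom) := by
    rw [hucv.aemeasurable_iff]
    have : AEMeasurable (fun t => |(γ - 2) * t| ^ (1 / (2 - γ))) (volume.restrict F.dom) := by
      fun_prop
    refine this.congr ?_
    filter_upwards [ae_restrict_mem hDm] with t ht using (hgval t ht).symm
  have hgne : g.dom.Nonempty := hne.image _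
  obtain ⟨r, Ψ, hr, hΨm, hΨcv, hf₂⟩ := invRelEscort_spec hα hgI hgne hgm hgpos_ae hup hh
  have hf₂cv := changeOfVar_invRelEscort hgpos_ae hr hΨcv hf₂
  have hrel : relUp γ α h f = invRelEscort α h g := by rw [relUp, ← hF]
  rw [hrel]
  set f₂ := invRelEscort α h g with hf₂def
  have hf₂pos : ∀ x ∈ h.dom, 0 < f₂.val x := fun x hx => by
    rw [hf₂]
    have := hgpos _ (hΨcv.bijOn.mapsTo hx)
    have := hh.pos x hx
    positivity
  have hf₂m : AEMeasurable f₂.val (volume.restrict f₂.dom) := by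
    have h1 := (hΨcv.aemeasurable_iff _).1 hgm
    have h2 := ((h1.const_mul r).pow_const (1 / α)).mul hh.aemeasurable
    exact h2.congr (Filter.Eventually.of_forall fun x => (hf₂ x).symm)
  have hf₂mass : ∫⁻ x in f₂.dom, ENNReal.ofReal (f₂.val x) = 1 := by
    have h1 := hf₂cv.lintegral_eq fun _ => 1
    have h2 := hucv.lintegral_eq fun _ => 1
    simp only [one_mul] at h1 h2
    exact h1.symm.trans (h2.trans hmass)
  obtain ⟨K, Y, hK, hYm, hf₃, hYcv⟩ := divergenceTransform_spec hδ hh (f := f₂) rfl hf₂m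
    (by filter_upwards [ae_restrict_mem hΩ] with x hx using hf₂pos x hx) hf₂mass
  have hΨinv := hf₂cv.symm_invFunOn hΩ
  set X : ℝ → ℝ := fun t => Function.invFunOn Ψ h.dom (u t) with hX
  have hXcv : ChangeOfVar X F.dom F.val h.dom f₂.val := hΨinv.comp hucv
  have hΨX : ∀ t ∈ F.dom, Ψ (X t) = u t := fun t ht =>
    Function.invFunOn_eq (hΨcv.bijOn.surjOn (hucv.bijOn.mapsTo ht))
  have hXm : StrictAntiOn X F.dom := by
    intro a ha b hb hab
    rw [← hΨm.lt_iff_lt (hXcv.bijOn.mapsTo hb) (hXcv.bijOn.mapsTo ha), hΨX a ha, hΨX b hb]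
    exact hum ha hb hab
  -- The ratio `f₂ / h` to the power `α` is `r * |(γ - 2) * t| ^ (1 / (2 - γ))`. The divergence
  -- transformation raises it to the power `δ` and adds the factor `K ^ α`.
  refine ⟨K ^ α * (r * |γ - 2| ^ (1 / (2 - γ))) ^ δ, Y ∘ X, by positivity,
    hYm.comp_strictAntiOn hXm hXcv.bijOn.mapsTo, hYcv.comp hXcv, fun t ht => ?_⟩
  have hx := hXcv.bijOn.mapsTo ht
  have hhx := hh.pos _ hx
  have hf₂x := hf₂pos _ hx
  have hhY := hh.pos _ (hYcv.bijOn.mapsTo hx)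
  have ht0 : 0 < t := h0 ht
  have hgt := hgpos' t ht
  simp only [Function.comp_apply]
  rw [hf₃ _ hx]
  refine ⟨by positivity, ?_⟩
  rw [mul_div_cancel_right₀ _ hhY.ne', hf₂, mul_div_cancel_right₀ _ hhx.ne', hΨX t ht,
    Real.mul_rpow hK.le (by positivity), ← Real.rpow_mul (by positivity),
    ← Real.rpow_mul (by positivity), show 1 / α * (δ * α) = δ by field_simp, hgval t ht, abs_mul,
    abs_of_pos ht0, Real.mul_rpow hγa.le ht0.le, ← mul_assoc r, Real.mul_rpow (by positivity)
    (by positivity), ← Real.rpow_mul ht0.le, ← mul_assoc]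
  congr 2
  rw [← neg_sub γ 2]
  field_simp

/-- The moments of `conjugatedDivergence` in terms of those of the original density. -/
theorem conjugatedDivergence_spec {γ α δ : ℝ} {f h : LineDensity} (hγ : γ ≠ 2) (hα : α ≠ 0)
    (hδ : δ ∈ Ioo (0 : ℝ) 1) (hf : f.IsPDF) (hh : h.IsPDF) (hdom : f.dom = h.dom)
    (hcum : ∀ x ∈ f.dom, relCumulative α f h x ≠ ⊤)
    (hup : InverseAdmissible α (up γ (relEscort α h f)))
    (hdown : InverseAdmissible α
      (down γ (relEscort α h (divergenceTransform δ h (relUp γ α h f))))) :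
    AEMeasurable (relCumulative α f h) (volume.restrict f.dom) ∧
    (∀ x ∈ f.dom, relCumulative α f h x ≠ 0) ∧
    (∀ x ∈ h.dom, relCumulative α (conjugatedDivergence γ α δ h f) h x ≠ ⊤) ∧
    ∃ C : ℝ, 0 < C ∧ ∀ p, relCumulativeMoment p α (conjugatedDivergence γ α δ h f) h =
      ENNReal.ofReal C ^ p * relCumulativeMoment (δ * p) α f h := by
  have hΩI := hh.isOpenInterval
  have hΩ := hh.isOpen.measurableSet
  have hfI := hf.isOpenInterval
  have hfmem := ae_restrict_mem (μ := volume) hf.isOpen.measurableSet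
  have hhm : AEMeasurable h.val (volume.restrict f.dom) := hdom ▸ hh.aemeasurable
  have hhpos : ∀ x ∈ f.dom, 0 < h.val x := fun x hx => hh.pos x (hdom ▸ hx)
  have hhpos_ae : ∀ᵐ x ∂volume.restrict f.dom, 0 < h.val x := by
    filter_upwards [hfmem] with x hx using hhpos x hx
  have hwm : AEMeasurable (fun t => f.val t ^ (1 - α) * h.val t ^ α) (volume.restrict f.dom) :=
    (hf.aemeasurable.pow_const _).mul (hhm.pow_const _)
  have hwpos : ∀ᵐ x ∂volume.restrict f.dom, 0 < f.val x ^ (1 - α) * h.val x ^ α := by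
    filter_upwards [hf.ae_pos, hhpos_ae] with x h1 h2
    positivity
  have hwnn : ∀ z, ∀ᵐ x ∂volume.restrict (f.dom ∩ Iio z), 0 ≤ f.val x ^ (1 - α) * h.val x ^ α :=
    fun z => ae_restrict_of_ae_restrict_of_subset inter_subset_left
      (hwpos.mono fun _ h => h.le)
  have hfin : ∀ z ∈ f.dom,
      IntegrableOn (fun t => f.val t ^ (1 - α) * h.val t ^ α) (f.dom ∩ Iio z) := fun z hz =>
    integrableOn_of_lintegral_ne_top
      (hwm.mono_measure (Measure.restrict_mono inter_subset_left le_rfl)) (hwnn z) (hcum z hz)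
  set y := escortVar α h f with hy
  have hydef : ∀ x, y x = ∫ t in f.dom ∩ Iio x, f.val t ^ (1 - α) * h.val t ^ α := fun x => by
    rw [hy, escortVar, primitiveFromLeft, if_pos hfin]
  obtain ⟨-, hDI, hycv1, hD0, hDlt⟩ := changeOfVar_cumulative hfI hwm hwpos hfin hydef
  obtain ⟨hFval, hycv⟩ := changeOfVar_relEscort hfI hf.ae_pos hhpos_ae hycv1
  have hcumy : ∀ x ∈ f.dom, relCumulative α f h x = ENNReal.ofReal (y x) := fun x hx => by
    rw [hydef, ofReal_integral_eq_lintegral_ofReal (hfin x hx) (hwnn x)]; rfl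
  set F := relEscort α h f with hF
  have hDI' : IsOpenInterval F.dom := hDI
  have hy0 : ∀ x ∈ f.dom, 0 < y x := fun x hx => hD0 (mem_image_of_mem y hx)
  have hFm : AEMeasurable F.val (volume.restrict F.dom) := by
    rw [hycv.aemeasurable_iff]
    refine ((hf.aemeasurable.div hhm).pow_const α).congr ?_
    filter_upwards [hfmem] with x hx using (hFval x hx).symm
  have hFpos : ∀ᵐ t ∂volume.restrict F.dom, 0 < F.val t := by
    rw [hycv.ae_iff]
    filter_upwards [hfmem] with x hx
    rw [hFval x hx]
    have := hf.pos x hx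
    have := hhpos x hx
    positivity
  have hFmass : ∫⁻ t in F.dom, ENNReal.ofReal (F.val t) = 1 := by
    have := hycv.lintegral_eq fun _ => 1
    simp only [one_mul] at this
    exact this.trans hf.mass
  obtain ⟨c, Z, hc, hZm, hZcv, hZ⟩ := divergenceTransform_relUp_spec (δ := δ) hγ hα hδ hh hF hDI'
    (hf.nonempty.image _) hD0 hFm hFpos hFmass hup
  set f₃ := divergenceTransform δ h (relUp γ α h f) with hf₃def
  have hf₃pos : ∀ x ∈ f₃.dom, 0 < f₃.val x := fun x hx => by
    obtain ⟨t, ht, rfl⟩ := hZcv.bijOn.surjOn hx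
    exact (hZ t ht).1
  have hf₃pos_ae : ∀ᵐ x ∂volume.restrict f₃.dom, 0 < f₃.val x := by
    filter_upwards [ae_restrict_mem hΩ] with x hx using hf₃pos x hx
  have hDmem := ae_restrict_mem (μ := volume) hDI'.isOpen.measurableSet
  have hf₃m : AEMeasurable f₃.val (volume.restrict f₃.dom) := by
    refine (hZcv.aemeasurable_iff _).2 ?_
    have h1 := (hZcv.aemeasurable_iff _).1 hh.aemeasurable
    have h2 : AEMeasurable (fun t : ℝ => (c * t ^ (-(δ / (γ - 2)))) ^ (1 / α))
      (volume.restrict F.dom) := by fun_prop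
    refine (h2.mul h1).congr ?_
    filter_upwards [hDmem] with t ht
    have h3 := (hZ t ht).1
    have h4 := hh.pos _ (hZcv.bijOn.mapsTo ht)
    simp only [Pi.mul_apply]
    rw [← (hZ t ht).2, ← Real.rpow_mul (by positivity), mul_one_div_cancel hα, Real.rpow_one,
      div_mul_cancel₀ _ h4.ne']
  -- The weight equals `f₃` divided by `(f₃ / h) ^ α`. Transported by `Z`, it is a continuous power
  -- of `t` times the integrable `F`.
  have hint : ∀ a ∈ f₃.dom, ∀ b ∈ f₃.dom, IntervalIntegrable
      (fun x => f₃.val x ^ (1 - α) * h.val x ^ α) volume a b := by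
    intro a ha b hb
    wlog hab : a ≤ b generalizing a b
    · exact (this b hb a ha (le_of_not_ge hab)).symm
    rw [intervalIntegrable_iff_integrableOn_Ioc_of_le hab]
    obtain ⟨s, hs, rfl⟩ := hZcv.bijOn.surjOn ha
    obtain ⟨t, ht, rfl⟩ := hZcv.bijOn.surjOn hb
    have hts : t ≤ s := (hZm.le_iff_ge hs ht).1 hab
    have hsub : Ioc (Z s) (Z t) ⊆ h.dom := hΩI.Ioc_subset ha hb
    have hw₃ : ∀ x ∈ f₃.dom, 0 < f₃.val x ^ (1 - α) * h.val x ^ α := fun x hx => by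
      have := hf₃pos x hx
      have := hh.pos x hx
      positivity
    refine integrableOn_of_lintegral_ne_top
      (((hf₃m.pow_const _).mul (hh.aemeasurable.pow_const _)).mono_measure
        (Measure.restrict_mono hsub le_rfl)) ?_ ?_
    · filter_upwards [ae_restrict_mem measurableSet_Ioc] with x hx using (hw₃ x (hsub hx)).le
    · have hcov := hZcv.setLIntegral_eq hDI'.isOpen.measurableSet (S := Ico t s)
        (T := Ioc (Z s) (Z t)) measurableSet_Ico measurableSet_Ioc (fun v hv => by
          rw [mem_Ico, mem_Ioc, hZm.le_iff_ge hv ht, hZm.lt_iff_gt hs hv, and_comm])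
        fun x => ENNReal.ofReal (((f₃.val x / h.val x) ^ α)⁻¹)
      rw [inter_eq_right.2 hsub] at hcov
      have hIco : Ico t s ⊆ F.dom := fun v hv => hDI'.ordConnected.out ht hs ⟨hv.1, hv.2.le⟩
      rw [inter_eq_right.2 hIco] at hcov
      have hl : ∫⁻ x in Ioc (Z s) (Z t), ENNReal.ofReal (f₃.val x ^ (1 - α) * h.val x ^ α) =
          ∫⁻ x in Ioc (Z s) (Z t),
            ENNReal.ofReal (((f₃.val x / h.val x) ^ α)⁻¹) * ENNReal.ofReal (f₃.val x) := by
        refine setLIntegral_congr_fun measurableSet_Ioc fun x hx => ?_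
        have h1 := hf₃pos x (hsub hx)
        have h2 := hh.pos x (hsub hx)
        rw [← ENNReal.ofReal_mul (by positivity), Real.div_rpow h1.le h2.le, Real.rpow_sub h1,
          Real.rpow_one, inv_div]
        congr 1
        ring
      have hr : ∫⁻ v in Ico t s, ENNReal.ofReal (((f₃.val (Z v) / h.val (Z v)) ^ α)⁻¹) *
            ENNReal.ofReal (F.val v) =
          ∫⁻ v in Ico t s, ENNReal.ofReal ((c * v ^ (-(δ / (γ - 2))))⁻¹ * F.val v) := by
        refine setLIntegral_congr_fun measurableSet_Ico fun v hv => ?_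
        have hv0 : 0 < v := hD0 (hIco hv)
        rw [(hZ v (hIco hv)).2, ← ENNReal.ofReal_mul (by positivity)]
      rw [hl, hcov, hr]
      have hcont : ContinuousOn (fun v : ℝ => (c * v ^ (-(δ / (γ - 2))))⁻¹) F.dom := by
        refine ContinuousOn.inv₀ (continuousOn_const.mul
          (continuousOn_id.rpow_const fun v hv => Or.inl (hD0 hv).ne')) fun v hv => ?_
        have : 0 < v := hD0 hv
        positivity
      have hFi : IntegrableOn F.val F.dom := integrableOn_of_lintegral_ne_top hFm
        (hFpos.mono fun _ h => h.le) (by simp [hFmass])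
      have h1 := intervalIntegrable_continuousOn_mul hDI' hcont
        (IntegrableOn.intervalIntegrable_of_mem hDI' hFi) t ht s hs
      rw [intervalIntegrable_iff_integrableOn_Ico_of_le hts] at h1
      exact (h1.lintegral_lt_top).ne
  obtain ⟨hVm, hGI, hGval, hVcv⟩ := relEscort_spec (f := f₃) (h := h) hΩI hf₃m hh.aemeasurable
    hf₃pos_ae hh.ae_pos hint
  set G := relEscort α h f₃ with hG
  obtain ⟨c', hc', hHI, hHm, hScv, hHpos⟩ := down_spec (T := escortVar α h f₃ ∘ Z) hγ hδ.1 hc hDI'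
    hD0 hFm hFpos hGI (hVm.comp_strictAntiOn hZm hZcv.bijOn.mapsTo) (hVcv.comp hZcv)
    fun t ht => (hGval _ (hZcv.bijOn.mapsTo ht)).trans (hZ t ht).2
  set H := down γ G with hH
  have hHne : H.dom.Nonempty := by
    obtain ⟨x, hx⟩ := hf.nonempty
    exact ⟨_, hScv.bijOn.mapsTo (mem_image_of_mem y hx)⟩
  obtain ⟨r, Ψ, hr, hΨm, hΨcv, hval⟩ := invRelEscort_spec hα hHI hHne hHm hHpos hdown hh
  have hf₄cv := changeOfVar_invRelEscort hHpos hr hΨcv hval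
  have hf₄ : conjugatedDivergence γ α δ h f = invRelEscort α h H := rfl
  rw [hf₄]
  set f₄ := invRelEscort α h H with hf₄def
  have hHpos' := (hΨcv.ae_iff _).1 hHpos
  -- Hence `Ψ` is, up to an additive constant, `r` times the cumulative integral of `f₄`.
  have hΨ1 : ChangeOfVar Ψ h.dom (fun x => r * (f₄.val x ^ (1 - α) * h.val x ^ α)) H.dom
      fun _ => 1 := by
    refine hΨcv.of_ratio ?_ (by simp) ?_
    · filter_upwards [hHpos'] with x hx
      positivity
    · filter_upwards [hHpos', hh.ae_pos] with x hx hhx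
      have hrH : 0 < r * H.val (Ψ x) := mul_pos hr hx
      rw [hval, one_mul, Real.mul_rpow (by positivity) hhx.le, ← Real.rpow_mul hrH.le,
        Real.mul_rpow hr.le hx.le]
      have e1 : r * (r ^ (1 / α * (1 - α)) * r ^ (-(1 / α))) = 1 := by
        rw [← Real.rpow_add hr, show 1 / α * (1 - α) + -(1 / α) = -1 by field_simp; ring,
          Real.rpow_neg_one, mul_inv_cancel₀ hr.ne']
      have e2 : H.val (Ψ x) ^ (1 / α * (1 - α)) * H.val (Ψ x) ^ (1 - 1 / α) = 1 := by
        rw [← Real.rpow_add hx, show 1 / α * (1 - α) + (1 - 1 / α) = 0 by field_simp; ring,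
          Real.rpow_zero]
      have e3 : h.val x ^ (1 - α) * h.val x ^ α = h.val x := by
        rw [← Real.rpow_add hhx, sub_add_cancel, Real.rpow_one]
      calc _ = (r * (r ^ (1 / α * (1 - α)) * r ^ (-(1 / α)))) *
            (H.val (Ψ x) ^ (1 / α * (1 - α)) * H.val (Ψ x) ^ (1 - 1 / α)) *
            (h.val x ^ (1 - α) * h.val x ^ α) := by ring
        _ = h.val x := by rw [e1, e2, e3, one_mul, one_mul]
  -- The interval of `H` starts at `0` because that of `F` does; this removes the additive constant.
  have hHIio : ∀ s ∈ H.dom, H.dom ∩ Iio s = Ioo 0 s := by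
    intro s hs
    obtain ⟨t, ht, rfl⟩ := hScv.bijOn.surjOn hs
    apply subset_antisymm
    · rintro v ⟨hv, hvt⟩
      obtain ⟨a, ha, rfl⟩ := hScv.bijOn.surjOn hv
      have : 0 < a := hD0 ha
      exact ⟨by positivity, hvt⟩
    · rintro v ⟨hv0, hvt⟩
      have ht0 : 0 < t := hD0 ht
      have hroot : c' * ((v / c') ^ (1 / δ)) ^ δ = v := by
        rw [← Real.rpow_mul (by positivity), one_div_mul_cancel hδ.1.ne', Real.rpow_one,
          mul_div_cancel₀ _ hc'.ne']
      have hlt : (v / c') ^ (1 / δ) < t := by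
        rw [← Real.rpow_lt_rpow_iff (by positivity) ht0.le hδ.1, ← mul_lt_mul_iff_right₀ hc', hroot]
        exact hvt
      have hmem : (v / c') ^ (1 / δ) ∈ F.dom := by
        have : (v / c') ^ (1 / δ) ∈ F.dom ∩ Iio t := by
          rw [show F.dom ∩ Iio t = Ioo 0 t from hDlt t ht]
          exact ⟨by positivity, hlt⟩
        exact this.1
      exact ⟨hroot ▸ hScv.bijOn.mapsTo hmem, hvt⟩
  have hcum₄ : ∀ x ∈ h.dom, relCumulative α f₄ h x = ENNReal.ofReal (r⁻¹ * Ψ x) := by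
    intro x hx
    have h1 := hΨ1.setLIntegral_eq hΩ (S := Iio x) (T := Iio (Ψ x)) measurableSet_Iio
      measurableSet_Iio (fun v hv => hΨm.lt_iff_lt hv hx) fun _ => 1
    rw [hHIio _ (hΨcv.bijOn.mapsTo hx)] at h1
    simp only [ENNReal.ofReal_one, mul_one, one_mul, lintegral_const, Measure.restrict_apply,
      MeasurableSet.univ, univ_inter, Real.volume_Ioo, sub_zero, ENNReal.ofReal_mul hr.le] at h1
    rw [lintegral_const_mul' _ _ ENNReal.ofReal_ne_top] at h1
    rw [ENNReal.ofReal_mul (by positivity), h1, ← mul_assoc, ← ENNReal.ofReal_mul (by positivity),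
      inv_mul_cancel₀ hr.ne', ENNReal.ofReal_one, one_mul]
    rfl
  refine ⟨?_, fun x hx => ?_, fun x hx => ?_, r⁻¹ * c', by positivity, fun p => ?_⟩
  · have h1 : AEMeasurable y (volume.restrict f.dom) :=
      (hycv.aemeasurable_iff fun t => t).1 aemeasurable_id
    refine h1.ennreal_ofReal.congr ?_
    filter_upwards [hfmem] with x hx using (hcumy x hx).symm
  · rw [hcumy x hx]
    exact (ENNReal.ofReal_pos.2 (hy0 x hx)).ne'
  · rw [hcum₄ x hx]
    exact ENNReal.ofReal_ne_top
  · have h1 : relCumulativeMoment p α f₄ h =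
        ∫⁻ x in h.dom, ENNReal.ofReal (r⁻¹ * Ψ x) ^ p * ENNReal.ofReal (f₄.val x) :=
      setLIntegral_congr_fun hΩ fun x hx => by simp only [hcum₄ x hx]
    have h2 := hf₄cv.lintegral_eq fun s => ENNReal.ofReal (r⁻¹ * s) ^ p
    -- Both `f₄` and `f` are carried to `H`, so the moment of `f₄` becomes an integral against `f`
    -- with `s = c' * y(x) ^ δ`.
    have h3 := (hScv.comp hycv).lintegral_eq fun s => ENNReal.ofReal (r⁻¹ * s) ^ p
    rw [h1, ← h2, h3, relCumulativeMoment, ← lintegral_const_mul' _ _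
      (ENNReal.rpow_ne_top_of_ne_zero (ENNReal.ofReal_pos.2 (by positivity)).ne'
        ENNReal.ofReal_ne_top)]
    refine setLIntegral_congr_fun hf.isOpen.measurableSet fun x hx => ?_
    have hyx := hy0 x hx
    change ENNReal.ofReal (r⁻¹ * (c' * y x ^ δ)) ^ p * ENNReal.ofReal (f.val x) = _
    have key : ENNReal.ofReal (r⁻¹ * (c' * y x ^ δ)) ^ p =
        ENNReal.ofReal (r⁻¹ * c') ^ p * ENNReal.ofReal (y x) ^ (δ * p) := by
      rw [ENNReal.rpow_mul, ENNReal.ofReal_rpow_of_pos hyx,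
        ← ENNReal.mul_rpow_of_ne_top ENNReal.ofReal_ne_top ENNReal.ofReal_ne_top,
        ← ENNReal.ofReal_mul (by positivity), mul_assoc]
    rw [hcumy x hx, key, mul_assoc]

end LineDensity

/-! ### The main theorem. -/

/-- Monotonicity of the relative cumulative-moment complexity. -/
theorem theorem4p3 (p q γ α δ : ℝ) (f h : LineDensity)
    (hp : p ≠ 0) (hq : q ≠ 0) (hγ : γ ≠ 2) (hα : α ≠ 0)
    (hsign : SignType.sign (p - q) = SignType.sign α * SignType.sign (γ - 2))
    (hδ : δ ∈ Set.Ioo (0 : ℝ) 1)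
    (hf : f.IsPDF) (hh : h.IsPDF) (hdom : f.dom = h.dom)
    -- The inner integral in the relative cumulative moments converges.
    (hcum : ∀ x ∈ f.dom, LineDensity.relCumulative α f h x ≠ ⊤)
    -- The quotient defining the complexity of `f` is not an indeterminate form.
    (hdet : 0 < p * q → LineDensity.relCumulativeMoment p α f h ≠ ⊤ ∨
      LineDensity.relCumulativeMoment q α f h ≠ ⊤)
    -- The two inverse relative differential-escort transformations may be applied.
    (hup : LineDensity.InverseAdmissible α
      (LineDensity.up γ (LineDensity.relEscort α h f)))
    (hdown : LineDensity.InverseAdmissible α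
      (LineDensity.down γ (LineDensity.relEscort α h
        (LineDensity.divergenceTransform δ h (LineDensity.relUp γ α h f))))) :
    -- The cumulative moments of the transformed density are defined, and finite with those of `f`.
    (∀ x ∈ (LineDensity.conjugatedDivergence γ α δ h f).dom,
      LineDensity.relCumulative α (LineDensity.conjugatedDivergence γ α δ h f) h x ≠ ⊤) ∧
    (LineDensity.relCumulativeMoment p α f h ≠ ⊤ →
      LineDensity.relCumulativeMoment p α (LineDensity.conjugatedDivergence γ α δ h f) h ≠ ⊤) ∧
    (LineDensity.relCumulativeMoment q α f h ≠ ⊤ →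
      LineDensity.relCumulativeMoment q α (LineDensity.conjugatedDivergence γ α δ h f) h ≠ ⊤) ∧
    LineDensity.momentComplexity p q γ α (LineDensity.conjugatedDivergence γ α δ h f) h ^ (1 / α) ≤
      LineDensity.momentComplexity p q γ α f h ^ (1 / α) := by
  obtain ⟨hm, hne, hfin, C, hC, hmom⟩ := LineDensity.conjugatedDivergence_spec hγ hα hδ hf hh hdom
    hcum hup hdown
  have hc0 : ∀ᵐ x ∂volume.restrict f.dom,
      LineDensity.relCumulative α f h x ≠ 0 ∧ LineDensity.relCumulative α f h x ≠ ⊤ := by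
    filter_upwards [ae_restrict_mem hf.isOpen.measurableSet] with x hx
    exact ⟨hne x hx, hcum x hx⟩
  have h0 : ∀ a, LineDensity.relCumulativeMoment a α f h ≠ 0 :=
    lintegral_rpow_mul_ne_zero hf.isOpen hf.nonempty hm hf.aemeasurable hc0 hf.ae_pos
  have hzero : LineDensity.relCumulativeMoment 0 α f h ≠ ⊤ := by
    simp [LineDensity.relCumulativeMoment, hf.mass]
  have hconv : ∀ a b s t : ℝ, 0 ≤ s → 0 ≤ t → s + t = 1 →
      LineDensity.relCumulativeMoment (s * a + t * b) α f h ≤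
        LineDensity.relCumulativeMoment a α f h ^ s * LineDensity.relCumulativeMoment b α f h ^ t :=
    fun a b s t hs ht hst => lintegral_rpow_mul_le hm hf.aemeasurable hc0 hs ht hst
  have hscale : ∀ a, LineDensity.relCumulativeMoment a α f h ≠ ⊤ →
      LineDensity.relCumulativeMoment a α (LineDensity.conjugatedDivergence γ α δ h f) h ≠ ⊤ := by
    intro a ha
    have h1 := ne_top_of_logConvex (m := fun a => LineDensity.relCumulativeMoment a α f h) hconv ha
      hzero hδ.1.le (sub_nonneg.2 hδ.2.le) (add_sub_cancel δ 1)
    rw [mul_zero, add_zero] at h1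
    rw [hmom]
    exact ENNReal.mul_ne_top (ENNReal.rpow_ne_top_of_ne_zero (ENNReal.ofReal_pos.2 hC).ne'
      ENNReal.ofReal_ne_top) h1
  refine ⟨hfin, hscale p, hscale q, ?_⟩
  rw [LineDensity.momentComplexity, LineDensity.momentComplexity, hmom, hmom]
  exact div_rpow_le_of_logConvex (m := fun a => LineDensity.relCumulativeMoment a α f h) h0 hzero
    hconv hC hp hq hγ hα hsign hδ hdet
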